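/- Let $G$ be a finite group and let $\pi : G \to U(H)$ be a unitary representation of $G$ on an infinite-dimensional complex Hilbert space $H$ (not necessarily separable). Regard $(H,\pi)$ as a metric structure in the sense of continuous logic: its universe is the closed unit ball of $H$ with the distance $\|x-y\|$, and the function symbols of the language $\mathcal L_\pi$ are $0$, $-x$, $\frac{x+y}{2}$, the truncated doubling $\dot 2$ ($\dot 2x=2x$ if $\|x\|\le \frac12$, and $\dot 2 x=x/\|x\|$ otherwise), multiplication by $e^{i\theta}$ for every $\theta\in 2\pi\mathbb Q$, and $\pi(g)$ for every $g\in G$. Let $IHS_\pi=\mathrm{Th}(H,\pi)$ be its complete continuous first-order theory. For an irreducible unitary representation $W$ of $G$ of degree $n_W$ with character $\chi_W$, let $\operatorname{mult}_W(\rho)\in\mathbb N\cup\{\infty\}$ be the multiplicity of $W$ in a unitary representation $(K,\rho)$ of $G$, that is, the largest number of pairwise orthogonal copies of $W$ in $K$ ($\infty$ if there are arbitrarily many), and let $P_W=\frac{n_W}{|G|}\sum_{g\in G}\overline{\chi_W(g)}\,\rho(g)$. Then: 1. $IHS_\pi$ is $\aleph_0$-categorical: any two separable models of $IHS_\pi$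 are isomorphic. 2. An $\mathcal L_\pi$-structure is a model of $IHS_\pi$ if and only if it is isomorphic to $(K,\rho)$ for some unitary representation $\rho$ of $G$ on an infinite-dimensional Hilbert space $K$ with $\operatorname{mult}_W(\rho)=\operatorname{mult}_W(\pi)$ for every irreducible unitary representation $W$ of $G$. 3. For every irreducible $W$ and every unitary representation $(K,\rho)$ of $G$ on a Hilbert space, $P_W$ is the orthogonal projection of $K$ onto the isotypic component of $W$ (the closed span of all copies of $W$ in $K$). It is definable: for every $\varepsilon>0$ there is an $\mathcal L_\pi$-formula $\varphi(x,y)$ that differs from $\|P_Wx-y\|$ by at most $\varepsilon$ on the unit ball of every such $(K,\rho)$. 4. For every irreducible $W$, the following expressions, in which all variables range over the unit ball, are the values of $\mathcal L_\pi$-sentences in every unitary representation $(K,\rho)$ of $G$ on a Hilbert space. For a finite family $v=(v_a)_{a\in A}$ put $$D(v)=\max\Big\{\max_{a}\big|\|v_a\|-1\big|,\ \max_a\|P_Wv_a-v_a\|,\ \max_{a\ne b}|\langle v_a,v_b\rangle|\Big\},$$ where a maximum over an empty set is $0$. The scheme $$\inf_{v_1,\dots,v_{n\cdot n_W}} D(v)=0\qquad(n\in\mathbb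 N)$$ holds in $(K,\rho)$ if and only if $\operatorname{mult}_W(\rho)=\infty$, and for each $d\in\mathbb N$ the single condition $$\inf_{v_1,\dots,v_{d\cdot n_W}}\ \sup_{x}\ \max\Big\{D(v),\ \Big\|P_Wx-\sum_{a}\langle v_a,P_Wx\rangle v_a\Big\|\Big\}=0$$ holds in $(K,\rho)$ if and only if $\operatorname{mult}_W(\rho)=d$. -/

import Mathlib

open scoped InnerProductSpace

universe u v w v₁ v₂

/-! ### Continuous first-order logic

One-sorted bounded metric structures, in languages whose only predicate symbol is the distance. -/

/-- A continuous language: function symbols with their arities and moduli of uniform continuity,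
together with a bound for the diameter. The distance is the only predicate symbol. -/
structure ContLanguage where
  /-- the function symbols of each arity -/
  Func : ℕ → Type*
  /-- the modulus of uniform continuity of each function symbol -/
  modulus : ∀ {n : ℕ}, Func n → ℝ → ℝ
  /-- the bound on the diameter -/
  bound : ℝ

namespace ContLanguage

/-- The underlying algebraic first-order language. It is used for its terms and for the
interpretations of function symbols. -/
abbrev lang (S : ContLanguage.{u}) : FirstOrder.Language.{u, 0} where
  Functions := S.Func
  Relations := fun _ => Empty

/-- `M`, with its distance and its interpretations of the function symbols, is a metric structure:
a nonempty complete metric space of diameter at most the bound, in which the interpretations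
respect the moduli (tuples carry the maximum metric). -/
class IsMetricStructure (S : ContLanguage.{u}) (M : Type v) [MetricSpace M]
    [S.lang.Structure M] : Prop where
  nonempty : Nonempty M
  complete : CompleteSpace M
  dist_le : ∀ x y : M, dist x y ≤ S.bound
  unif_cont : ∀ {n : ℕ} (f : S.Func n) (ε : ℝ), 0 < ε → ∀ x y : Fin n → M,
    dist x y < S.modulus f ε →
      dist (FirstOrder.Language.Structure.funMap (L := S.lang) (M := M) f x)
        (FirstOrder.Language.Structure.funMap (L := S.lang) (M := M) f y) ≤ ε

/-- Formulas of continuous logic in the free variables `0, …, n - 1`: distances between terms,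
continuous connectives, and the quantifiers `sup` and `inf`, which bind the last variable. -/
inductive Formula (S : ContLanguage.{u}) : ℕ → Type u
  | dist {n : ℕ} (s t : S.lang.Term (Fin n)) : Formula S n
  | conn {n k : ℕ} (u : C(Fin k → ℝ, ℝ)) (φ : Fin k → Formula S n) : Formula S n
  | sup {n : ℕ} (φ : Formula S (n + 1)) : Formula S n
  | inf {n : ℕ} (φ : Formula S (n + 1)) : Formula S n

/-- The value of a formula in a structure. -/
noncomputable def Formula.value {S : ContLanguage.{u}} (M : Type v) [MetricSpace M]
    [S.lang.Structure M] : {n : ℕ} → S.Formula n → (Fin n → M) → ℝ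
  | _, .dist s t, a => Dist.dist (s.realize a) (t.realize a)
  | _, .conn u φ, a => u fun i => (φ i).value M a
  | _, .sup φ, a => ⨆ b : M, φ.value M (Fin.snoc a b)
  | _, .inf φ, a => ⨅ b : M, φ.value M (Fin.snoc a b)

/-- Formulas take bounded values in metric structures, so that the suprema and infima above are
genuine. -/
theorem Formula.exists_abs_value_le {S : ContLanguage.{u}} (M : Type v) [MetricSpace M]
    [S.lang.Structure M] [hM : S.IsMetricStructure M] {n : ℕ} (φ : S.Formula n) :
    ∃ B : ℝ, ∀ a : Fin n → M, |φ.value M a| ≤ B := by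
  have := hM.nonempty
  induction φ with
  | dist s t =>
    refine ⟨S.bound, fun a => ?_⟩
    simp only [Formula.value, abs_of_nonneg dist_nonneg]
    exact hM.dist_le _ _
  | @conn n k u φ ih =>
    choose B hB using ih
    obtain ⟨C, hC⟩ := (isCompact_univ_pi fun i => isCompact_Icc (a := -B i) (b := B i)).exists_bound_of_continuousOn
      u.continuous.continuousOn
    refine ⟨C, fun a => ?_⟩
    simp only [Formula.value]
    exact hC _ fun i _ => abs_le.1 (hB i a)
  | sup φ ih =>
    obtain ⟨B, hB⟩ := ih
    refine ⟨B, fun a => ?_⟩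
    simp only [Formula.value]
    have h := fun b : M => abs_le.1 (hB (Fin.snoc a b))
    refine abs_le.2 ⟨?_, ciSup_le fun b => (h b).2⟩
    exact (h (Classical.arbitrary M)).1.trans
      (le_ciSup (f := fun b : M => φ.value M (Fin.snoc a b))
        ⟨B, by rintro _ ⟨b, rfl⟩; exact (h b).2⟩ _)
  | inf φ ih =>
    obtain ⟨B, hB⟩ := ih
    refine ⟨B, fun a => ?_⟩
    simp only [Formula.value]
    have h := fun b : M => abs_le.1 (hB (Fin.snoc a b))
    refine abs_le.2 ⟨le_ciInf fun b => (h b).1, ?_⟩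
    exact (ciInf_le (f := fun b : M => φ.value M (Fin.snoc a b))
        ⟨-B, by rintro _ ⟨b, rfl⟩; exact (h b).1⟩ _).trans (h (Classical.arbitrary M)).2

/-- Sentences are formulas without free variables. -/
abbrev Sentence (S : ContLanguage.{u}) : Type u := S.Formula 0

/-- The value of a sentence. -/
noncomputable def Sentence.val {S : ContLanguage.{u}} (φ : S.Sentence) (M : Type v)
    [MetricSpace M] [S.lang.Structure M] : ℝ :=
  Formula.value M φ Fin.elim0

/-- A theory is a set of closed conditions `φ = 0`, given by the sentences `φ`. -/
abbrev Theory (S : ContLanguage.{u}) : Type u := Set S.Sentence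

/-- `M` satisfies all the conditions of `T`. -/
def Theory.Models {S : ContLanguage.{u}} (T : S.Theory) (M : Type v) [MetricSpace M]
    [S.lang.Structure M] : Prop :=
  ∀ φ ∈ T, φ.val M = 0

/-- The complete theory `Th(M)`. -/
def completeTheory (S : ContLanguage.{u}) (M : Type v) [MetricSpace M] [S.lang.Structure M] :
    S.Theory :=
  {φ | φ.val M = 0}

/-- Isomorphisms: surjective isometries commuting with all function symbols. -/
structure Iso (S : ContLanguage.{u}) (M : Type v) (N : Type w) [MetricSpace M]
    [S.lang.Structure M] [MetricSpace N] [S.lang.Structure N] extends M ≃ᵢ N where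
  map_fun : ∀ {n : ℕ} (f : S.Func n) (x : Fin n → M),
    toFun (FirstOrder.Language.Structure.funMap (L := S.lang) f x) =
      FirstOrder.Language.Structure.funMap (L := S.lang) f fun i => toFun (x i)

/-- `T` is `ℵ₀`-categorical: any two separable models of `T` are isomorphic. -/
def Theory.IsAleph0Categorical {S : ContLanguage.{u}} (T : S.Theory) : Prop :=
  ∀ (M : Type v) [MetricSpace M] [S.lang.Structure M] [S.IsMetricStructure M]
    (N : Type w) [MetricSpace N] [S.lang.Structure N] [S.IsMetricStructure N],
    TopologicalSpace.SeparableSpace M → TopologicalSpace.SeparableSpace N →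
    T.Models M → T.Models N → Nonempty (S.Iso M N)

end ContLanguage

/-! ### Unitary representations as metric structures -/

/-- A unitary representation of `G` on `H`: a homomorphism from `G` to the group of unitary
operators of `H`. -/
abbrev UnitaryRep (G : Type u) [Group G] (H : Type v) [NormedAddCommGroup H]
    [InnerProductSpace ℂ H] : Type max u v :=
  G →* (H ≃ₗᵢ[ℂ] H)

/-- The function symbols: `0`, `-x`, the truncated doubling, `(x + y) / 2`, the multiplications by
`e ^ (2πiq)` for rational `q`, and the group elements. -/
inductive RepFunc (G : Type u) : ℕ → Type u
  | zero : RepFunc G 0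
  | neg : RepFunc G 1
  | dbl : RepFunc G 1
  | mid : RepFunc G 2
  | rot (q : ℚ) : RepFunc G 1
  | act (g : G) : RepFunc G 1

/-- The language of Hilbert spaces (on the unit ball, which has diameter at most `2`) expanded by
a symbol for each element of `G`. The modulus of the truncated doubling is `ε / 2`, all others
are `ε`. -/
noncomputable def repLanguage (G : Type u) : ContLanguage.{u} where
  Func := RepFunc G
  modulus := fun f ε =>
    match f with
    | .dbl => ε / 2
    | _ => ε
  bound := 2

namespace UnitaryRep

variable {G : Type u} [Group G] {H : Type v} [NormedAddCommGroup H] [InnerProductSpace ℂ H]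

/-- The carrier of the metric structure `(H, π)`: the closed unit ball of `H`. -/
def Ball (_π : UnitaryRep G H) : Type v := Metric.closedBall (0 : H) 1

/-- The distance on the unit ball is `‖x - y‖`. -/
instance (π : UnitaryRep G H) : MetricSpace π.Ball :=
  inferInstanceAs (MetricSpace (Metric.closedBall (0 : H) 1))

/-- A point of the unit ball as a vector. -/
def Ball.vec {π : UnitaryRep G H} (x : π.Ball) : H := x.1

theorem Ball.norm_vec_le {π : UnitaryRep G H} (x : π.Ball) : ‖x.vec‖ ≤ 1 :=
  mem_closedBall_zero_iff.1 x.2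

/-- A vector of norm at most `1` as a point of the unit ball. -/
def Ball.mk (π : UnitaryRep G H) (x : H) (hx : ‖x‖ ≤ 1) : π.Ball :=
  ⟨x, mem_closedBall_zero_iff.2 hx⟩

theorem Ball.dist_eq {π : UnitaryRep G H} (x y : π.Ball) : dist x y = ‖x.vec - y.vec‖ :=
  dist_eq_norm x.vec y.vec

/-- The truncated doubling: `2 • x` if `‖x‖ ≤ 1 / 2`, and `‖x‖⁻¹ • x` otherwise. -/
noncomputable def dblVec (x : H) : H := (max ‖x‖ (1 / 2))⁻¹ • x

theorem norm_dblVec_le (x : H) : ‖dblVec x‖ ≤ 1 := by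
  have h : 0 < max ‖x‖ (1 / 2 : ℝ) := lt_max_of_lt_right (by norm_num)
  rw [dblVec, norm_smul, norm_inv, Real.norm_of_nonneg h.le, inv_mul_le_iff₀ h, mul_one]
  exact le_max_left _ _

theorem norm_mid_le {x y : H} (hx : ‖x‖ ≤ 1) (hy : ‖y‖ ≤ 1) : ‖(1 / 2 : ℝ) • (x + y)‖ ≤ 1 := by
  rw [norm_smul, Real.norm_of_nonneg (by norm_num)]
  linarith [norm_add_le x y]

/-- The scalar `e ^ (2πiq)`. -/
noncomputable def rotScalar (q : ℚ) : ℂ := Complex.exp (2 * Real.pi * q * Complex.I)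

theorem norm_rotScalar (q : ℚ) : ‖rotScalar q‖ = 1 := by
  have : rotScalar q = Complex.exp ((2 * Real.pi * q : ℝ) * Complex.I) := by
    simp [rotScalar]
  rw [this, Complex.norm_exp_ofReal_mul_I]

/-- The interpretations of the function symbols in `(H, π)`. -/
noncomputable def ballFun (π : UnitaryRep G H) : {n : ℕ} → RepFunc G n → (Fin n → π.Ball) → π.Ball
  | _, .zero, _ => Ball.mk π 0 (by simp)
  | _, .neg, x => Ball.mk π (-(x 0).vec) (by simpa using (x 0).norm_vec_le)
  | _, .dbl, x => Ball.mk π (dblVec (x 0).vec) (norm_dblVec_le _)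
  | _, .mid, x => Ball.mk π ((1 / 2 : ℝ) • ((x 0).vec + (x 1).vec))
      (norm_mid_le (x 0).norm_vec_le (x 1).norm_vec_le)
  | _, .rot q, x => Ball.mk π (rotScalar q • (x 0).vec)
      (by simpa [norm_smul, norm_rotScalar] using (x 0).norm_vec_le)
  | _, .act g, x => Ball.mk π (π g (x 0).vec) (by simpa using (x 0).norm_vec_le)

noncomputable instance (π : UnitaryRep G H) : (repLanguage G).lang.Structure π.Ball where
  funMap := fun f x => π.ballFun f x
  RelMap := fun r => r.elim

theorem norm_dblVec_sub_le (x y : H) : ‖dblVec x - dblVec y‖ ≤ 2 * ‖x - y‖ := by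
  set a : ℝ := max ‖x‖ (1 / 2) with ha
  set b : ℝ := max ‖y‖ (1 / 2) with hb
  have ha2 : 1 / 2 ≤ a := le_max_right _ _
  have hb2 : 1 / 2 ≤ b := le_max_right _ _
  have ha0 : 0 < a := by linarith
  have hb0 : 0 < b := by linarith
  have hxa : ‖x‖ ≤ a := le_max_left _ _
  have hyb : ‖y‖ ≤ b := le_max_left _ _
  have hx0 := norm_nonneg x
  have hy0 := norm_nonneg y
  have key : 0 ≤ (a - b) * (‖x‖ ^ 2 * b - ‖y‖ ^ 2 * a) := by
    rcases lt_trichotomy a b with h | h | h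
    · have hy : ‖y‖ = b := by
        rcases max_choice ‖y‖ (1 / 2 : ℝ) with h' | h'
        · rw [hb, h']
        · exact absurd (hb.trans h') (by linarith)
      rw [hy]
      have : ‖x‖ ^ 2 ≤ a ^ 2 := by gcongr
      have h4 : 0 ≤ a * b - ‖x‖ ^ 2 := by nlinarith
      nlinarith [mul_nonneg (mul_nonneg (sub_nonneg.2 h.le) hb0.le) h4]
    · simp [h]
    · have hx : ‖x‖ = a := by
        rcases max_choice ‖x‖ (1 / 2 : ℝ) with h' | h'
        · rw [ha, h']
        · exact absurd (ha.trans h') (by linarith)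
      rw [hx]
      have : ‖y‖ ^ 2 ≤ b ^ 2 := by gcongr
      have h4 : 0 ≤ a * b - ‖y‖ ^ 2 := by nlinarith
      nlinarith [mul_nonneg (mul_nonneg (sub_nonneg.2 h.le) ha0.le) h4]
  have hab : 1 / 4 ≤ a * b := by nlinarith
  have h1 : dblVec x - dblVec y = ((a * b)⁻¹ : ℝ) • (b • x - a • y) := by
    rw [smul_sub, smul_smul, smul_smul, dblVec, dblVec, ← ha, ← hb]
    congr 2 <;> field_simp
  let _ : InnerProductSpace ℝ H := InnerProductSpace.rclikeToReal ℂ H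
  have h2 : ‖b • x - a • y‖ ^ 2 ≤ a * b * ‖x - y‖ ^ 2 := by
    rw [norm_sub_sq_real, norm_sub_sq_real, norm_smul, norm_smul, real_inner_smul_left,
      real_inner_smul_right, Real.norm_of_nonneg ha0.le, Real.norm_of_nonneg hb0.le]
    nlinarith [key]
  have h3 : ‖b • x - a • y‖ ≤ 2 * (a * b) * ‖x - y‖ := by
    refine abs_le_of_sq_le_sq' ?_ (by positivity) |>.2
    refine h2.trans ?_
    have : a * b ≤ 4 * (a * b) ^ 2 := by nlinarith
    nlinarith [mul_le_mul_of_nonneg_right this (sq_nonneg ‖x - y‖)]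
  rw [h1, norm_smul, Real.norm_of_nonneg (by positivity), inv_mul_le_iff₀ (by positivity)]
  linarith

/-- `(H, π)` is a metric structure. -/
instance [CompleteSpace H] (π : UnitaryRep G H) : (repLanguage G).IsMetricStructure π.Ball where
  nonempty := ⟨Ball.mk π 0 (by simp)⟩
  complete := (Metric.isClosed_closedBall (x := (0 : H)) (ε := 1)).completeSpace_coe
  dist_le := fun x y => by
    rw [Ball.dist_eq]
    exact (norm_sub_le _ _).trans (by
      have := x.norm_vec_le
      have := y.norm_vec_le
      simp only [repLanguage]
      linarith)
  unif_cont := by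
    intro n f ε hε x y h
    change dist (π.ballFun f x) (π.ballFun f y) ≤ ε
    have key : ∀ i, ‖(x i).vec - (y i).vec‖ ≤ dist x y := fun i => by
      rw [← Ball.dist_eq]; exact dist_le_pi_dist x y i
    rw [Ball.dist_eq]
    cases f with
    | zero => simpa [ballFun, Ball.mk, Ball.vec] using hε.le
    | neg =>
      change dist x y < ε at h
      change ‖-(x 0).vec - -(y 0).vec‖ ≤ ε
      rw [neg_sub_neg, norm_sub_rev]
      exact (key 0).trans h.le
    | dbl =>
      change dist x y < ε / 2 at h
      change ‖dblVec (x 0).vec - dblVec (y 0).vec‖ ≤ ε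
      linarith [norm_dblVec_sub_le (x 0).vec (y 0).vec, key 0]
    | mid =>
      change dist x y < ε at h
      change ‖(1 / 2 : ℝ) • ((x 0).vec + (x 1).vec) - (1 / 2 : ℝ) • ((y 0).vec + (y 1).vec)‖ ≤ ε
      rw [← smul_sub, add_sub_add_comm, norm_smul, Real.norm_of_nonneg (by norm_num)]
      linarith [norm_add_le ((x 0).vec - (y 0).vec) ((x 1).vec - (y 1).vec), key 0, key 1]
    | rot q =>
      change dist x y < ε at h
      change ‖rotScalar q • (x 0).vec - rotScalar q • (y 0).vec‖ ≤ ε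
      rw [← smul_sub, norm_smul, norm_rotScalar, one_mul]
      exact (key 0).trans h.le
    | act g =>
      change dist x y < ε at h
      change ‖π g (x 0).vec - π g (y 0).vec‖ ≤ ε
      rw [← map_sub, LinearIsometryEquiv.norm_map]
      exact (key 0).trans h.le

/-- The theory `IHS_π = Th(H, π)`. -/
noncomputable def theory (π : UnitaryRep G H) : (repLanguage G).Theory :=
  (repLanguage G).completeTheory π.Ball

/-! ### Multiplicities and isotypic projections -/

variable {W : Type w} [NormedAddCommGroup W] [InnerProductSpace ℂ W]

/-- The underlying linear representation. -/
def toRepresentation (π : UnitaryRep G H) : Representation ℂ G H where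
  toFun g := (π g).toLinearEquiv.toLinearMap
  map_one' := by ext; simp
  map_mul' g h := by ext; simp

/-- `f` exhibits a copy of `σ` inside `π`: it is a `G`-equivariant isometric embedding. -/
def IsCopy (σ : UnitaryRep G W) (π : UnitaryRep G H) (f : W →ₗᵢ[ℂ] H) : Prop :=
  ∀ g w, f (σ g w) = π g (f w)

/-- The multiplicity of `σ` in `π`: the largest number of pairwise orthogonal copies of `σ` in
`π`, or `⊤` if there are arbitrarily many. -/
noncomputable def mult (σ : UnitaryRep G W) (π : UnitaryRep G H) : ℕ∞ :=
  ⨆ (k : ℕ) (_ : ∃ f : Fin k → (W →ₗᵢ[ℂ] H), (∀ i, IsCopy σ π (f i)) ∧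
    ∀ i j, i ≠ j → ∀ w w', ⟪f i w, f j w'⟫_ℂ = 0), (k : ℕ∞)

/-- The isotypic component: the closed linear span of all copies of `σ` in `π`. -/
noncomputable def isotypic (σ : UnitaryRep G W) (π : UnitaryRep G H) : Submodule ℂ H :=
  (⨆ (f : W →ₗᵢ[ℂ] H) (_ : IsCopy σ π f), LinearMap.range f.toLinearMap).topologicalClosure

/-- The operator `(n / |G|) ∑ g, conj (χ g) • π g`, where `n` and `χ` are the degree and the
character of `σ`. -/
noncomputable def charProj [Fintype G] (σ : UnitaryRep G W) (π : UnitaryRep G H) (v : H) : H :=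
  ((Module.finrank ℂ W : ℂ) / (Fintype.card G : ℂ)) •
    ∑ g : G, (starRingEnd ℂ) (σ.toRepresentation.character g) • π g v

/-- How far the finite family `v` in the unit ball is from being an orthonormal family of vectors
fixed by the projection `P` of `σ`: the maximum of all `|‖v a‖ - 1|`, all `‖P (v a) - v a‖` and
all `|⟪v a, v b⟫|` with `a ≠ b`. -/
noncomputable def frameDefect [Fintype G] (σ : UnitaryRep G W) (π : UnitaryRep G H) {ι : Type}
    (v : ι → π.Ball) : ℝ :=
  ⨆ a : ι, max (max |‖(v a).vec‖ - 1| ‖charProj σ π (v a).vec - (v a).vec‖)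
    (⨆ b : {b : ι // a ≠ b}, ‖⟪(v a).vec, (v b).vec⟫_ℂ‖)

/-- The value of the `n`-th axiom of the scheme for infinite multiplicity of `σ`: the infimum,
over `n` collections of `dim σ` vectors of the unit ball, of their defect. -/
noncomputable def infMultValue [Fintype G] (σ : UnitaryRep G W) (n : ℕ) (π : UnitaryRep G H) : ℝ :=
  ⨅ v : Fin n × Fin (Module.finrank ℂ W) → π.Ball, frameDefect σ π v

/-- The value of the axiom for multiplicity `d` of `σ`: the infimum, over `d` collections of
`dim σ` vectors `v` of the unit ball, of the supremum over `x` in the unit ball of the maximum of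
the defect of `v` and of `‖P x - ∑ a, ⟪v a, P x⟫ • v a‖`. -/
noncomputable def finMultValue [Fintype G] (σ : UnitaryRep G W) (d : ℕ) (π : UnitaryRep G H) : ℝ :=
  ⨅ v : Fin d × Fin (Module.finrank ℂ W) → π.Ball, ⨆ x : π.Ball,
    max (frameDefect σ π v)
      ‖charProj σ π x.vec - ∑ a, ⟪(v a).vec, charProj σ π x.vec⟫_ℂ • (v a).vec‖

end UnitaryRep

/-!
The group `G` is finite, so every orbit spans a finite-dimensional invariant subspace, and a
unitary representation `π` is governed by the multiplicities of the irreducible representations.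

*Isotypic projections.* For `u` in an irreducible `W` and `x` in `H` the operator
`w ↦ ∑ g, ⟪σ g u, w⟫ • π g x` intertwines (`coefMap`), so by Schur's lemma it is a multiple of an
isometric copy of `W` (`Intertwines.exists_isCopy`). The operator `charProj` is a sum of values of
such maps, hence it takes values in the isotypic component, and a trace computation shows that it
is the identity on copies of `W`. It is symmetric, so it is the orthogonal projection. A maximal
family of orthogonal copies exhausts the isotypic component, whose dimension is therefore the
multiplicity times the degree. Together with the fact that almost orthonormal families are
linearly independent, this gives the meaning of the axioms (`forall_infMultValue_eq_zero_iff`,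
`finMultValue_eq_zero_iff`).

*Back and forth.* Let `π` and `ρ` have the same multiplicities. An equivariant isometry between
finite-dimensional invariant subspaces can be extended to any further vector, by adding matching
irreducible copies in the orthogonal complements; a copy is available on the other side by
counting dimensions in the isotypic components (`IsPartialIso.exists_extension`). Hence all
formulas take the same values at corresponding tuples (`IsPartialIso.value_eq`), so `π` and `ρ`
have the same theory, and in the separable case a countable back and forth gives a unitary
equivalence (`SameMult.exists_equiv`).

*Formulas.* Inner products of terms are polynomials in distances, so every continuous function of
the Gram matrix of finitely many terms is the value of a formula (`gramFormula`). This covers the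
norms of linear combinations, and with them the projections and the axioms, exactly and not only
approximately.

*Models.* In a model of the theory the same expressions in distances define a kernel, which is
positive semidefinite because this is a set of universal conditions true in `π`. The model embeds
into the Hilbert space of the kernel, all algebraic identities transfer, and the image is the
whole unit ball (`mem_of_closed_under_operations`). So every model is the unit ball of a
representation (`exists_iso_ball_of_models`), with the multiplicities prescribed by the axioms.
-/

namespace UnitaryRep

/-! ### Intertwining maps and Schur's lemma -/

variable {G : Type u} [Group G] {H : Type v} [NormedAddCommGroup H] [InnerProductSpace ℂ H]
  {W : Type w} [NormedAddCommGroup W] [InnerProductSpace ℂ W]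

/-- A subspace is invariant if it is stable under all operators `π g`. -/
def Invariant (π : UnitaryRep G H) (A : Submodule ℂ H) : Prop :=
  ∀ g, ∀ x ∈ A, π g x ∈ A

/-- A linear map intertwines two unitary representations if it is `G`-equivariant. -/
def Intertwines (σ : UnitaryRep G W) (π : UnitaryRep G H) (T : W →ₗ[ℂ] H) : Prop :=
  ∀ g w, T (σ g w) = π g (T w)

@[simp]
theorem toRepresentation_apply (π : UnitaryRep G H) (g : G) (x : H) :
    π.toRepresentation g x = π g x := rfl

theorem mul_apply' (π : UnitaryRep G H) (g h : G) (x : H) : π (g * h) x = π g (π h x) := by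
  rw [map_mul]; rfl

@[simp]
theorem one_apply' (π : UnitaryRep G H) (x : H) : π 1 x = x := by
  rw [map_one]; rfl

@[simp]
theorem inv_apply_self' (π : UnitaryRep G H) (g : G) (x : H) : π g⁻¹ (π g x) = x := by
  rw [← mul_apply']; simp

@[simp]
theorem apply_inv_self' (π : UnitaryRep G H) (g : G) (x : H) : π g (π g⁻¹ x) = x := by
  rw [← mul_apply']; simp

theorem inner_apply_left (π : UnitaryRep G H) (g : G) (x y : H) :
    ⟪π g x, y⟫_ℂ = ⟪x, π g⁻¹ y⟫_ℂ := by
  conv_lhs => rw [← apply_inv_self' π g y]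
  exact (π g).inner_map_map _ _

theorem Invariant.orthogonal {π : UnitaryRep G H} {A : Submodule ℂ H} (hA : π.Invariant A) :
    π.Invariant Aᗮ := by
  intro g x hx y hy
  have := hx _ (hA g⁻¹ y hy)
  rw [← this, inner_apply_left, inv_inv]

theorem Invariant.inf {π : UnitaryRep G H} {A B : Submodule ℂ H} (hA : π.Invariant A)
    (hB : π.Invariant B) : π.Invariant (A ⊓ B) :=
  fun g x hx => ⟨hA g x hx.1, hB g x hx.2⟩

theorem Invariant.sup {π : UnitaryRep G H} {A B : Submodule ℂ H} (hA : π.Invariant A)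
    (hB : π.Invariant B) : π.Invariant (A ⊔ B) := by
  intro g x hx
  obtain ⟨a, ha, b, hb, rfl⟩ := Submodule.mem_sup.1 hx
  rw [map_add]
  exact Submodule.add_mem_sup (hA g a ha) (hB g b hb)

/-- The span of the orbit of `x`. -/
def orbitSpan (π : UnitaryRep G H) (x : H) : Submodule ℂ H :=
  Submodule.span ℂ (Set.range fun g => π g x)

theorem apply_mem_orbitSpan (π : UnitaryRep G H) (g : G) (x : H) : π g x ∈ π.orbitSpan x :=
  Submodule.subset_span ⟨g, rfl⟩

theorem self_mem_orbitSpan (π : UnitaryRep G H) (x : H) : x ∈ π.orbitSpan x := by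
  simpa using π.apply_mem_orbitSpan 1 x

theorem invariant_orbitSpan (π : UnitaryRep G H) (x : H) : π.Invariant (π.orbitSpan x) := by
  intro g y hy
  induction hy using Submodule.span_induction with
  | mem y hy =>
    obtain ⟨h, rfl⟩ := hy
    simpa only [← mul_apply'] using π.apply_mem_orbitSpan (g * h) x
  | zero => simp
  | add y z _ _ hy hz => rw [map_add]; exact add_mem hy hz
  | smul c y _ hy => rw [map_smul]; exact Submodule.smul_mem _ _ hy

instance [Finite G] (π : UnitaryRep G H) (x : H) : FiniteDimensional ℂ (π.orbitSpan x) :=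
  FiniteDimensional.span_of_finite ℂ (Set.finite_range _)

theorem nontrivial_of_irreducible {σ : UnitaryRep G W} (hσ : σ.toRepresentation.IsIrreducible) :
    Nontrivial W := by
  by_contra h
  rw [not_nontrivial_iff_subsingleton] at h
  obtain ⟨a, b, hab⟩ := hσ.toNontrivial
  apply hab
  ext x
  rw [Subsingleton.elim x 0]
  exact ⟨fun _ => b.toSubmodule.zero_mem, fun _ => a.toSubmodule.zero_mem⟩

theorem Invariant.eq_bot_or_eq_top {σ : UnitaryRep G W}
    (hσ : σ.toRepresentation.IsIrreducible) {A : Submodule ℂ W} (hA : σ.Invariant A) :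
    A = ⊥ ∨ A = ⊤ := by
  rcases hσ.eq_bot_or_eq_top ⟨A, fun g v hv => hA g v hv⟩ with h | h
  · exact Or.inl (congrArg Subrepresentation.toSubmodule h)
  · exact Or.inr (congrArg Subrepresentation.toSubmodule h)

theorem isIrreducible_of_invariant [Nontrivial W] {σ : UnitaryRep G W}
    (h : ∀ A : Submodule ℂ W, σ.Invariant A → A = ⊥ ∨ A = ⊤) :
    σ.toRepresentation.IsIrreducible where
  exists_pair_ne := by
    refine ⟨⊥, ⊤, fun h => ?_⟩
    exact bot_ne_top (α := Submodule ℂ W) (congrArg Subrepresentation.toSubmodule h)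
  eq_bot_or_eq_top A := by
    rcases h A.toSubmodule (fun g x hx => A.apply_mem_toSubmodule g hx) with h | h
    · exact Or.inl (Subrepresentation.toSubmodule_injective h)
    · exact Or.inr (Subrepresentation.toSubmodule_injective h)

/-- Schur's lemma: the commutant of an irreducible representation is scalar. -/
theorem Intertwines.exists_eq_smul [FiniteDimensional ℂ W] {σ : UnitaryRep G W}
    (hσ : σ.toRepresentation.IsIrreducible) {T : W →ₗ[ℂ] W} (hT : Intertwines σ σ T) :
    ∃ c : ℂ, ∀ w, T w = c • w := by
  have := nontrivial_of_irreducible hσ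
  obtain ⟨c, hc⟩ := Module.End.exists_eigenvalue T
  refine ⟨c, fun w => ?_⟩
  have hinv : σ.Invariant (Module.End.eigenspace T c) := by
    intro g x hx
    rw [Module.End.mem_eigenspace_iff] at hx ⊢
    rw [hT, hx, map_smul]
  rcases hinv.eq_bot_or_eq_top hσ with h | h
  · exact absurd h hc
  · exact Module.End.mem_eigenspace_iff.1 (h ▸ Submodule.mem_top)

/-- An intertwining map out of an irreducible representation is a multiple of an isometry, and
so it is a multiple of a copy: its modulus commutes with the representation. -/
theorem Intertwines.exists_isCopy [FiniteDimensional ℂ W] [CompleteSpace H] {σ : UnitaryRep G W}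
    (hσ : σ.toRepresentation.IsIrreducible) {π : UnitaryRep G H} {T : W →ₗ[ℂ] H}
    (hT : Intertwines σ π T) (h0 : T ≠ 0) :
    ∃ f : W →ₗᵢ[ℂ] H, IsCopy σ π f ∧ ∃ c : ℂ, ∀ w, T w = c • f w := by
  have : CompleteSpace W := FiniteDimensional.complete ℂ W
  let T' : W →L[ℂ] H := LinearMap.toContinuousLinearMap T
  have hT' : ∀ w, T' w = T w := fun w => rfl
  have hS : Intertwines σ σ (T'.adjoint ∘L T').toLinearMap := by
    intro g w
    refine ext_inner_left ℂ fun z => ?_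
    change ⟪z, T'.adjoint (T' (σ g w))⟫_ℂ = ⟪z, σ g (T'.adjoint (T' w))⟫_ℂ
    have h1 : σ g (T'.adjoint (T' w)) = σ g⁻¹⁻¹ (T'.adjoint (T' w)) := by rw [inv_inv]
    rw [h1, ← inner_apply_left, ContinuousLinearMap.adjoint_inner_right,
      ContinuousLinearMap.adjoint_inner_right, hT', hT', hT', hT, hT,
      inner_apply_left, inv_inv, hT']
  -- `T* T` is the scalar `c`, so `T` multiplies all norms by `√c`
  obtain ⟨c, hc⟩ := hS.exists_eq_smul hσ
  have hnorm : ∀ w, ‖T w‖ ^ 2 = c.re * ‖w‖ ^ 2 := by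
    intro w
    have h1 : ⟪T' w, T' w⟫_ℂ = ⟪w, c • w⟫_ℂ := by
      rw [← hc w, ← ContinuousLinearMap.adjoint_inner_right]; rfl
    rw [hT', inner_smul_right, inner_self_eq_norm_sq_to_K, inner_self_eq_norm_sq_to_K] at h1
    have := congrArg Complex.re h1
    simpa [← Complex.ofReal_pow] using this
  obtain ⟨w₀, hw₀⟩ : ∃ w, T w ≠ 0 := by
    by_contra! h
    exact h0 (LinearMap.ext h)
  have hcpos : 0 < c.re := by
    have h1 := hnorm w₀
    have h2 : 0 < ‖T w₀‖ := norm_pos_iff.2 hw₀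
    by_contra! h
    nlinarith [sq_nonneg ‖w₀‖]
  set r := Real.sqrt c.re with hr
  have hr0 : 0 < r := Real.sqrt_pos.2 hcpos
  have hr2 : r ^ 2 = c.re := Real.sq_sqrt hcpos.le
  have hn : ∀ w, ‖T w‖ = r * ‖w‖ := by
    intro w
    rw [← sq_eq_sq₀ (norm_nonneg _) (by positivity), hnorm, mul_pow, hr2]
  have hrc : (r : ℂ) ≠ 0 := by exact_mod_cast hr0.ne'
  refine ⟨⟨(r : ℂ)⁻¹ • T, fun w => ?_⟩, fun g w => ?_, r, fun w => ?_⟩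
  · rw [LinearMap.smul_apply, norm_smul, hn, norm_inv, Complex.norm_real,
      Real.norm_of_nonneg hr0.le]
    field_simp
  · change (r : ℂ)⁻¹ • T (σ g w) = π g ((r : ℂ)⁻¹ • T w)
    rw [hT, map_smul]
  · change T w = (r : ℂ) • (r : ℂ)⁻¹ • T w
    rw [smul_smul, mul_inv_cancel₀ hrc, one_smul]

/-! ### The isotypic projection -/

section CharProj

variable [Fintype G]

/-- The average of the rank one operators `w ↦ ⟪σ g u, w⟫ • π g x`, up to normalization. -/
noncomputable def coefMap (σ : UnitaryRep G W) (π : UnitaryRep G H) (u : W) (x : H) :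
    W →ₗ[ℂ] H :=
  ∑ g : G, (innerₛₗ ℂ (σ g u)).smulRight (π g x)

theorem coefMap_apply (σ : UnitaryRep G W) (π : UnitaryRep G H) (u : W) (x : H) (w : W) :
    coefMap σ π u x w = ∑ g : G, ⟪σ g u, w⟫_ℂ • π g x := by
  simp [coefMap]

theorem coefMap_intertwines (σ : UnitaryRep G W) (π : UnitaryRep G H) (u : W) (x : H) :
    Intertwines σ π (coefMap σ π u x) := by
  intro h w
  rw [coefMap_apply, coefMap_apply, map_sum, ← Equiv.sum_comp (Equiv.mulLeft h)]
  refine Finset.sum_congr rfl fun g _ => ?_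
  rw [Equiv.coe_mulLeft, mul_apply', mul_apply', (σ h).inner_map_map, map_smul]

theorem coefMap_mem (σ : UnitaryRep G W) {π : UnitaryRep G H} {A : Submodule ℂ H}
    (hA : π.Invariant A) (u : W) {x : H} (hx : x ∈ A) (w : W) : coefMap σ π u x w ∈ A := by
  rw [coefMap_apply]
  exact Submodule.sum_mem _ fun g _ => Submodule.smul_mem _ _ (hA g x hx)

/-- The isotypic projection through the maps `coefMap`, by expanding the character in an
orthonormal basis. -/
theorem charProj_eq_sum_coefMap [FiniteDimensional ℂ W] (σ : UnitaryRep G W)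
    (π : UnitaryRep G H) (x : H) :
    charProj σ π x = ((Module.finrank ℂ W : ℂ) / (Fintype.card G : ℂ)) •
      ∑ i, coefMap σ π (stdOrthonormalBasis ℂ W i) x (stdOrthonormalBasis ℂ W i) := by
  rw [charProj]
  congr 1
  simp_rw [coefMap_apply]
  rw [Finset.sum_comm]
  refine Finset.sum_congr rfl fun g _ => ?_
  rw [← Finset.sum_smul, Representation.character,
    LinearMap.trace_eq_sum_inner _ (stdOrthonormalBasis ℂ W), map_sum]
  simp

/-- On the irreducible representation itself `coefMap` is scalar by Schur's lemma; the scalar is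
read off from the trace. -/
theorem coefMap_self [FiniteDimensional ℂ W] {σ : UnitaryRep G W}
    (hσ : σ.toRepresentation.IsIrreducible) (u x w : W) :
    coefMap σ σ u x w =
      (((Fintype.card G : ℂ) / (Module.finrank ℂ W : ℂ)) * ⟪u, x⟫_ℂ) • w := by
  have := nontrivial_of_irreducible hσ
  obtain ⟨c, hc⟩ := (coefMap_intertwines σ σ u x).exists_eq_smul hσ
  have htr : LinearMap.trace ℂ W (coefMap σ σ u x) = Fintype.card G * ⟪u, x⟫_ℂ := by
    rw [coefMap, map_sum]
    simp_rw [LinearMap.trace_smulRight]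
    simp
  have htr' : LinearMap.trace ℂ W (coefMap σ σ u x) = c * Module.finrank ℂ W := by
    have : coefMap σ σ u x = c • LinearMap.id := LinearMap.ext hc
    rw [this, map_smul, LinearMap.trace_id, smul_eq_mul]
  have hn : (Module.finrank ℂ W : ℂ) ≠ 0 := by
    exact_mod_cast (Module.finrank_pos (R := ℂ) (M := W)).ne'
  rw [hc]
  congr 1
  rw [htr] at htr'
  field_simp
  rw [htr']

/-- On the irreducible representation itself the isotypic projection is the identity: the
scalars of the maps `coefMap` recombine to the expansion in the orthonormal basis. -/
theorem charProj_self [FiniteDimensional ℂ W] {σ : UnitaryRep G W}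
    (hσ : σ.toRepresentation.IsIrreducible) (w : W) : charProj σ σ w = w := by
  have := nontrivial_of_irreducible hσ
  have hn : (Module.finrank ℂ W : ℂ) ≠ 0 := by
    exact_mod_cast (Module.finrank_pos (R := ℂ) (M := W)).ne'
  have hG : (Fintype.card G : ℂ) ≠ 0 := by exact_mod_cast Fintype.card_ne_zero
  rw [charProj_eq_sum_coefMap]
  simp_rw [coefMap_self hσ, mul_smul]
  rw [← Finset.smul_sum, OrthonormalBasis.sum_repr' (stdOrthonormalBasis ℂ W) w, smul_smul,
    div_mul_div_cancel₀ hG, div_self hn, one_smul]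

/-- The operator `charProj` as a continuous linear map. -/
noncomputable def charProjL (σ : UnitaryRep G W) (π : UnitaryRep G H) : H →L[ℂ] H :=
  ((Module.finrank ℂ W : ℂ) / (Fintype.card G : ℂ)) •
    ∑ g : G, (starRingEnd ℂ) (σ.toRepresentation.character g) •
      ((π g).toContinuousLinearEquiv : H →L[ℂ] H)

theorem charProjL_apply (σ : UnitaryRep G W) (π : UnitaryRep G H) (x : H) :
    charProjL σ π x = charProj σ π x := by
  simp [charProjL, charProj]

/-- The isotypic projection commutes with all intertwining maps. -/
theorem charProj_map {H' : Type*} [NormedAddCommGroup H'] [InnerProductSpace ℂ H']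
    (σ : UnitaryRep G W) {π : UnitaryRep G H} {π' : UnitaryRep G H'} {T : H →ₗ[ℂ] H'}
    (hT : Intertwines π π' T) (x : H) : charProj σ π' (T x) = T (charProj σ π x) := by
  simp only [charProj, map_smul, map_sum]
  congr 1
  exact Finset.sum_congr rfl fun g _ => by rw [hT]

theorem charProj_mem (σ : UnitaryRep G W) {π : UnitaryRep G H} {A : Submodule ℂ H}
    (hA : π.Invariant A) {x : H} (hx : x ∈ A) : charProj σ π x ∈ A :=
  Submodule.smul_mem _ _ (Submodule.sum_mem _ fun g _ => Submodule.smul_mem _ _ (hA g x hx))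

omit [Fintype G] in
theorem conj_character [FiniteDimensional ℂ W] (σ : UnitaryRep G W) (g : G) :
    (starRingEnd ℂ) (σ.toRepresentation.character g) = σ.toRepresentation.character g⁻¹ := by
  rw [Representation.character, Representation.character,
    LinearMap.trace_eq_sum_inner _ (stdOrthonormalBasis ℂ W),
    LinearMap.trace_eq_sum_inner _ (stdOrthonormalBasis ℂ W), map_sum]
  refine Finset.sum_congr rfl fun i _ => ?_
  rw [inner_conj_symm, toRepresentation_apply, toRepresentation_apply, inner_apply_left]

theorem inner_charProj_left [FiniteDimensional ℂ W] (σ : UnitaryRep G W) (π : UnitaryRep G H)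
    (x y : H) : ⟪charProj σ π x, y⟫_ℂ = ⟪x, charProj σ π y⟫_ℂ := by
  simp only [charProj, inner_smul_left, inner_smul_right, sum_inner, inner_sum, map_div₀,
    map_natCast]
  congr 1
  rw [← Equiv.sum_comp (Equiv.inv G)]
  refine Finset.sum_congr rfl fun g _ => ?_
  rw [Equiv.inv_apply, inner_apply_left, inv_inv, conj_character, inv_inv, conj_character]

variable [FiniteDimensional ℂ W] {σ : UnitaryRep G W} (hσ : σ.toRepresentation.IsIrreducible)
include hσ

theorem charProj_copy {π : UnitaryRep G H} {f : W →ₗᵢ[ℂ] H} (hf : IsCopy σ π f) (w : W) :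
    charProj σ π (f w) = f w := by
  have := charProj_map σ (T := f.toLinearMap) (π := σ) (π' := π) hf w
  rw [charProj_self hσ] at this
  exact this

theorem charProj_of_mem_isotypic {π : UnitaryRep G H} {x : H} (hx : x ∈ isotypic σ π) :
    charProj σ π x = x := by
  have hcl : IsClosed ((LinearMap.eqLocus (charProjL σ π).toLinearMap LinearMap.id :
      Submodule ℂ H) : Set H) :=
    isClosed_eq (charProjL σ π).continuous continuous_id
  have hle : isotypic σ π ≤ LinearMap.eqLocus (charProjL σ π).toLinearMap LinearMap.id := by
    refine Submodule.topologicalClosure_minimal _ (iSup₂_le fun f hf => ?_) hcl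
    rintro _ ⟨w, rfl⟩
    exact (charProjL_apply σ π _).trans (charProj_copy hσ hf w)
  exact (charProjL_apply σ π x).symm.trans (hle hx)

theorem charProj_mem_isotypic [CompleteSpace H] (π : UnitaryRep G H) (x : H) :
    charProj σ π x ∈ isotypic σ π := by
  rw [charProj_eq_sum_coefMap]
  refine Submodule.smul_mem _ _ (Submodule.sum_mem _ fun i _ => ?_)
  by_cases h0 : coefMap σ π (stdOrthonormalBasis ℂ W i) x = 0
  · rw [h0]; exact Submodule.zero_mem _
  · obtain ⟨f, hf, c, hc⟩ := (coefMap_intertwines σ π _ x).exists_isCopy hσ h0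
    rw [hc]
    refine Submodule.smul_mem _ _ (Submodule.le_topologicalClosure _ ?_)
    exact Submodule.mem_iSup_of_mem f (Submodule.mem_iSup_of_mem hf ⟨_, rfl⟩)

theorem mem_isotypic_iff [CompleteSpace H] {π : UnitaryRep G H} {x : H} :
    x ∈ isotypic σ π ↔ charProj σ π x = x :=
  ⟨charProj_of_mem_isotypic hσ, fun h => h ▸ charProj_mem_isotypic hσ π x⟩

theorem charProj_charProj [CompleteSpace H] (π : UnitaryRep G H) (x : H) :
    charProj σ π (charProj σ π x) = charProj σ π x :=
  charProj_of_mem_isotypic hσ (charProj_mem_isotypic hσ π x)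

theorem inner_sub_charProj {π : UnitaryRep G H} (x : H) {y : H}
    (hy : y ∈ isotypic σ π) : ⟪y, x - charProj σ π x⟫_ℂ = 0 := by
  rw [inner_sub_right, ← inner_charProj_left, charProj_of_mem_isotypic hσ hy, sub_self]

theorem norm_charProj_le [CompleteSpace H] (π : UnitaryRep G H) (x : H) :
    ‖charProj σ π x‖ ≤ ‖x‖ := by
  have h : ⟪charProj σ π x, x - charProj σ π x⟫_ℂ = 0 :=
    inner_sub_charProj hσ x (charProj_mem_isotypic hσ π x)
  have h1 := norm_add_sq_eq_norm_sq_add_norm_sq_of_inner_eq_zero _ _ h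
  rw [add_sub_cancel] at h1
  nlinarith [norm_nonneg x, norm_nonneg (charProj σ π x), mul_self_nonneg ‖x - charProj σ π x‖]

/-- A copy is found inside every invariant subspace on which the projection does not vanish. -/
theorem exists_isCopy_mem [CompleteSpace H] {π : UnitaryRep G H} {A : Submodule ℂ H}
    (hA : π.Invariant A) {x : H} (hx : x ∈ A) (h0 : charProj σ π x ≠ 0) :
    ∃ f : W →ₗᵢ[ℂ] H, IsCopy σ π f ∧ ∀ w, f w ∈ A := by
  have : ∃ i, coefMap σ π (stdOrthonormalBasis ℂ W i) x ≠ 0 := by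
    by_contra! h
    apply h0
    rw [charProj_eq_sum_coefMap]
    simp [h]
  obtain ⟨i, hi⟩ := this
  obtain ⟨f, hf, c, hc⟩ := (coefMap_intertwines σ π _ x).exists_isCopy hσ hi
  refine ⟨f, hf, fun w => ?_⟩
  have hc0 : c ≠ 0 := by
    rintro rfl
    exact hi (LinearMap.ext fun w => by simpa using hc w)
  have : f w = c⁻¹ • coefMap σ π (stdOrthonormalBasis ℂ W i) x w := by
    rw [hc, smul_smul, inv_mul_cancel₀ hc0, one_smul]
  rw [this]
  exact Submodule.smul_mem _ _ (coefMap_mem σ hA _ hx w)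

end CharProj

end UnitaryRep

namespace UnitaryRep

/-! ### Multiplicity and the dimension of the isotypic component -/

section Mult

variable {G : Type u} [Group G] {H : Type v} [NormedAddCommGroup H] [InnerProductSpace ℂ H]
  {W : Type w} [NormedAddCommGroup W] [InnerProductSpace ℂ W]

/-- The multiplicity is a supremum over an initial segment of `ℕ`, so finite lower bounds are
witnessed. -/
theorem le_mult_iff {σ : UnitaryRep G W} {π : UnitaryRep G H} {k : ℕ} :
    (k : ℕ∞) ≤ mult σ π ↔ ∃ f : Fin k → (W →ₗᵢ[ℂ] H), (∀ i, IsCopy σ π (f i)) ∧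
      ∀ i j, i ≠ j → ∀ w w', ⟪f i w, f j w'⟫_ℂ = 0 := by
  refine ⟨fun h => ?_, fun h => le_iSup₂_of_le k h le_rfl⟩
  by_contra hk
  have hk0 : k ≠ 0 := by
    rintro rfl
    exact hk ⟨Fin.elim0, fun i => i.elim0, fun i => i.elim0⟩
  have : mult σ π ≤ (k - 1 : ℕ) := by
    refine iSup₂_le fun j ⟨f, hf, hf'⟩ => ?_
    rw [Nat.cast_le]
    by_contra hj
    have hkj : k ≤ j := by omega
    refine hk ⟨fun i => f (Fin.castLE hkj i), fun i => hf _, fun i i' hi => hf' _ _ ?_⟩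
    exact fun h => hi (Fin.castLE_injective hkj h)
  have := h.trans this
  rw [Nat.cast_le] at this
  omega

variable [FiniteDimensional ℂ W]

/-- The images of an orthonormal basis under pairwise orthogonal isometries. -/
theorem orthonormal_copies {k : ℕ} {f : Fin k → (W →ₗᵢ[ℂ] H)}
    (hf : ∀ i j, i ≠ j → ∀ w w', ⟪f i w, f j w'⟫_ℂ = 0) :
    Orthonormal ℂ fun a : Fin k × Fin (Module.finrank ℂ W) =>
      f a.1 (stdOrthonormalBasis ℂ W a.2) := by
  rw [orthonormal_iff_ite]
  rintro ⟨i, j⟩ ⟨i', j'⟩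
  by_cases hi : i = i'
  · subst hi
    rw [LinearIsometry.inner_map_map, orthonormal_iff_ite.1 (stdOrthonormalBasis ℂ W).orthonormal]
    simp
  · rw [hf i i' hi, if_neg]
    exact fun h => hi (congrArg Prod.fst h)

theorem apply_mem_span_copies {k : ℕ} (f : Fin k → (W →ₗᵢ[ℂ] H)) (i : Fin k) (w : W) :
    f i w ∈ Submodule.span ℂ (Set.range fun a : Fin k × Fin (Module.finrank ℂ W) =>
      f a.1 (stdOrthonormalBasis ℂ W a.2)) := by
  rw [← OrthonormalBasis.sum_repr' (stdOrthonormalBasis ℂ W) w, map_sum]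
  refine Submodule.sum_mem _ fun j _ => ?_
  rw [map_smul]
  exact Submodule.smul_mem _ _ (Submodule.subset_span ⟨(i, j), rfl⟩)

variable [Fintype G] {σ : UnitaryRep G W}

omit [FiniteDimensional ℂ W] [Fintype G] in
theorem IsCopy.mem_isotypic {π : UnitaryRep G H} {f : W →ₗᵢ[ℂ] H} (hf : IsCopy σ π f) (w : W) :
    f w ∈ isotypic σ π :=
  Submodule.le_topologicalClosure _
    (Submodule.mem_iSup_of_mem f (Submodule.mem_iSup_of_mem hf ⟨w, rfl⟩))

omit [Fintype G] in
theorem exists_orthonormal_of_le_mult {π : UnitaryRep G H} {k : ℕ} (h : (k : ℕ∞) ≤ mult σ π) :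
    ∃ v : Fin k × Fin (Module.finrank ℂ W) → H, Orthonormal ℂ v ∧ ∀ a, v a ∈ isotypic σ π := by
  obtain ⟨f, hf, hf'⟩ := le_mult_iff.1 h
  exact ⟨_, orthonormal_copies hf', fun a => (hf a.1).mem_isotypic _⟩

variable [CompleteSpace H] (hσ : σ.toRepresentation.IsIrreducible)
include hσ

/-- A maximal family of orthogonal copies exhausts the isotypic component: otherwise a vector of
the component orthogonal to all of them would generate another copy. -/
theorem exists_orthonormal_span_of_mult_eq {π : UnitaryRep G H} {d : ℕ}
    (h : mult σ π = d) : ∃ v : Fin d × Fin (Module.finrank ℂ W) → H, Orthonormal ℂ v ∧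
      Submodule.span ℂ (Set.range v) = isotypic σ π := by
  obtain ⟨f, hf, hf'⟩ := le_mult_iff.1 h.ge
  refine ⟨_, orthonormal_copies hf', le_antisymm ?_ ?_⟩
  · refine Submodule.span_le.2 ?_
    rintro _ ⟨a, rfl⟩
    exact (hf a.1).mem_isotypic _
  set v : Fin d × Fin (Module.finrank ℂ W) → H :=
    fun a => f a.1 (stdOrthonormalBasis ℂ W a.2) with hv
  set S := Submodule.span ℂ (Set.range v) with hS
  have hSE : S ≤ isotypic σ π := by
    refine Submodule.span_le.2 ?_
    rintro _ ⟨a, rfl⟩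
    exact (hf a.1).mem_isotypic _
  have hSinv : π.Invariant S := by
    intro g x hx
    induction hx using Submodule.span_induction with
    | mem x hx =>
      obtain ⟨a, rfl⟩ := hx
      rw [hv]
      simp only
      rw [← hf a.1]
      exact apply_mem_span_copies f _ _
    | zero => simp
    | add x y _ _ hx hy => rw [map_add]; exact add_mem hx hy
    | smul c x _ hx => rw [map_smul]; exact Submodule.smul_mem _ _ hx
  have : FiniteDimensional ℂ S := FiniteDimensional.span_of_finite ℂ (Set.finite_range _)
  by_contra hnot
  obtain ⟨x, hx, hxS⟩ := Set.not_subset.1 hnot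
  set y := x - S.starProjection x with hy
  have hyS : y ∈ Sᗮ := Submodule.sub_starProjection_mem_orthogonal x
  have hyE : y ∈ isotypic σ π :=
    sub_mem hx (hSE (Submodule.starProjection_apply_mem S x))
  have hy0 : y ≠ 0 := by
    intro h0
    apply hxS
    rw [sub_eq_zero.1 h0]
    exact Submodule.starProjection_apply_mem S x
  obtain ⟨f', hcopy, hmem⟩ := exists_isCopy_mem hσ hSinv.orthogonal hyS
    (by rwa [charProj_of_mem_isotypic hσ hyE])
  have hle : ((d + 1 : ℕ) : ℕ∞) ≤ mult σ π := by
    refine le_mult_iff.2 ⟨Fin.snoc f f', ?_, ?_⟩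
    · intro i
      induction i using Fin.lastCases with
      | last => simpa using hcopy
      | cast i => simpa using hf i
    · have h1 : ∀ i w w', ⟪f i w, f' w'⟫_ℂ = 0 := fun i w w' =>
        hmem w' _ (apply_mem_span_copies f i w)
      intro i j hij w w'
      induction i using Fin.lastCases with
      | last =>
        induction j using Fin.lastCases with
        | last => exact absurd rfl hij
        | cast j =>
          simp only [Fin.snoc_last, Fin.snoc_castSucc]
          rw [← inner_conj_symm, h1, map_zero]
      | cast i =>
        induction j using Fin.lastCases with
        | last => simpa using h1 i w w'
        | cast j =>
          simp only [Fin.snoc_castSucc]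
          exact hf' i j (fun h => hij (by rw [h])) w w'
  rw [h, Nat.cast_le] at hle
  omega

theorem finiteDimensional_isotypic {π : UnitaryRep G H} {d : ℕ} (h : mult σ π = d) :
    FiniteDimensional ℂ (isotypic σ π) ∧
      Module.finrank ℂ (isotypic σ π) = d * Module.finrank ℂ W := by
  obtain ⟨v, hv, hs⟩ := exists_orthonormal_span_of_mult_eq hσ h
  rw [← hs]
  refine ⟨FiniteDimensional.span_of_finite ℂ (Set.finite_range _), ?_⟩
  rw [finrank_span_eq_card hv.linearIndependent]
  simp

/-- Linearly independent vectors of the isotypic component bound the multiplicity from below, by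
comparing dimensions. -/
theorem le_mult_of_linearIndependent {π : UnitaryRep G H} {k : ℕ}
    {v : Fin k × Fin (Module.finrank ℂ W) → H} (hv : LinearIndependent ℂ v)
    (hmem : ∀ a, v a ∈ isotypic σ π) : (k : ℕ∞) ≤ mult σ π := by
  have := nontrivial_of_irreducible hσ
  by_contra! hlt
  obtain ⟨d, hd⟩ := ENat.ne_top_iff_exists.1 hlt.ne_top
  rw [← hd, Nat.cast_lt] at hlt
  obtain ⟨hfin, hrank⟩ := finiteDimensional_isotypic hσ hd.symm
  have hv' : LinearIndependent ℂ fun a => (⟨v a, hmem a⟩ : isotypic σ π) :=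
    LinearIndependent.of_comp (isotypic σ π).subtype hv
  have := hv'.fintype_card_le_finrank
  rw [hrank] at this
  simp only [Fintype.card_prod, Fintype.card_fin] at this
  have := Nat.le_of_mul_le_mul_right this Module.finrank_pos
  omega

omit [Fintype G] [CompleteSpace H] in
theorem mult_ne_top {π : UnitaryRep G H} (hfin : FiniteDimensional ℂ (isotypic σ π)) :
    mult σ π ≠ ⊤ := by
  have := nontrivial_of_irreducible hσ
  intro htop
  obtain ⟨v, hv, hmem⟩ := exists_orthonormal_of_le_mult (σ := σ) (π := π)
    (k := Module.finrank ℂ (isotypic σ π) + 1) (by rw [htop]; exact le_top)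
  have hv' : LinearIndependent ℂ fun a => (⟨v a, hmem a⟩ : isotypic σ π) :=
    LinearIndependent.of_comp (isotypic σ π).subtype hv.linearIndependent
  have := hv'.fintype_card_le_finrank
  simp only [Fintype.card_prod, Fintype.card_fin] at this
  have h1 : 0 < Module.finrank ℂ W := Module.finrank_pos
  nlinarith

end Mult

/-! ### The values of the axioms -/

section Values

variable {G : Type u} [Group G] {H : Type v} [NormedAddCommGroup H] [InnerProductSpace ℂ H]
  {W : Type w} [NormedAddCommGroup W] [InnerProductSpace ℂ W]

/-- Almost orthonormal families are linearly independent, since their Gram matrix is diagonally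
dominant. -/
theorem linearIndependent_of_norm_inner_le {ι : Type*} [Fintype ι] {v : ι → H} {δ c : ℝ}
    (hδ0 : 0 ≤ δ) (hδ : ∀ a b, a ≠ b → ‖⟪v a, v b⟫_ℂ‖ ≤ δ) (hc : ∀ a, c ≤ ‖⟪v a, v a⟫_ℂ‖)
    (h : Fintype.card ι * δ < c) : LinearIndependent ℂ v := by
  classical
  refine Matrix.linearIndependent_of_det_gram_ne_zero (det_ne_zero_of_sum_row_lt_diag fun a => ?_)
  refine lt_of_le_of_lt ?_ (h.trans_le (hc a))
  calc ∑ b ∈ Finset.univ.erase a, ‖Matrix.gram ℂ v a b‖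
      ≤ ∑ b ∈ Finset.univ.erase a, δ :=
        Finset.sum_le_sum fun b hb => hδ a b (Finset.ne_of_mem_erase hb).symm
    _ ≤ ∑ b : ι, δ := Finset.sum_le_sum_of_subset_of_nonneg (Finset.erase_subset _ _)
        fun _ _ _ => hδ0
    _ = Fintype.card ι * δ := by simp

variable [Fintype G] {ι : Type} {σ : UnitaryRep G W} {π : UnitaryRep G H}

theorem frameDefect_nonneg (v : ι → π.Ball) : 0 ≤ frameDefect σ π v :=
  Real.iSup_nonneg fun _ => le_max_of_le_left (le_max_of_le_left (abs_nonneg _))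

section Finite

variable [Finite ι]

theorem le_frameDefect (v : ι → π.Ball) (a : ι) :
    max (max |‖(v a).vec‖ - 1| ‖charProj σ π (v a).vec - (v a).vec‖)
      (⨆ b : {b : ι // a ≠ b}, ‖⟪(v a).vec, (v b).vec⟫_ℂ‖) ≤ frameDefect σ π v :=
  le_ciSup (f := fun a : ι => max (max |‖(v a).vec‖ - 1| ‖charProj σ π (v a).vec - (v a).vec‖)
      (⨆ b : {b : ι // a ≠ b}, ‖⟪(v a).vec, (v b).vec⟫_ℂ‖)) (Set.finite_range _).bddAbove a

theorem abs_norm_sub_one_le_frameDefect (v : ι → π.Ball) (a : ι) :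
    |‖(v a).vec‖ - 1| ≤ frameDefect σ π v :=
  ((le_max_left _ _).trans (le_max_left _ _)).trans (le_frameDefect v a)

theorem norm_charProj_sub_le_frameDefect (v : ι → π.Ball) (a : ι) :
    ‖charProj σ π (v a).vec - (v a).vec‖ ≤ frameDefect σ π v :=
  ((le_max_right _ _).trans (le_max_left _ _)).trans (le_frameDefect v a)

theorem norm_inner_le_frameDefect (v : ι → π.Ball) {a b : ι} (hab : a ≠ b) :
    ‖⟪(v a).vec, (v b).vec⟫_ℂ‖ ≤ frameDefect σ π v :=
  ((le_ciSup (f := fun b : {b : ι // a ≠ b} => ‖⟪(v a).vec, (v b).vec⟫_ℂ‖)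
    (Set.finite_range _).bddAbove ⟨b, hab⟩).trans (le_max_right _ _)).trans (le_frameDefect v a)

end Finite

/-- The points of the unit ball given by an orthonormal family. -/
def ballFamily (π : UnitaryRep G H) {v : ι → H} (hv : Orthonormal ℂ v) (a : ι) : π.Ball :=
  Ball.mk π (v a) (hv.1 a).le

omit [Fintype G] in
@[simp]
theorem vec_ballFamily {v : ι → H} (hv : Orthonormal ℂ v) (a : ι) :
    (ballFamily π hv a).vec = v a := rfl

variable [FiniteDimensional ℂ W] (hσ : σ.toRepresentation.IsIrreducible)
include hσ

theorem frameDefect_ballFamily {v : ι → H} (hv : Orthonormal ℂ v)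
    (hmem : ∀ a, v a ∈ isotypic σ π) : frameDefect σ π (ballFamily π hv) = 0 := by
  refine le_antisymm (Real.iSup_le (fun a => ?_) le_rfl) (frameDefect_nonneg _)
  refine max_le (max_le ?_ ?_) (Real.iSup_le (fun b => ?_) le_rfl)
  · simp [hv.1 a]
  · simp [charProj_of_mem_isotypic hσ (hmem a)]
  · simp [hv.2 b.2]

theorem infMultValue_eq_zero {n : ℕ} (h : (n : ℕ∞) ≤ mult σ π) : infMultValue σ n π = 0 := by
  obtain ⟨v, hv, hmem⟩ := exists_orthonormal_of_le_mult h
  refine le_antisymm ?_ (Real.iInf_nonneg fun v => frameDefect_nonneg v)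
  rw [← frameDefect_ballFamily hσ hv hmem]
  exact ciInf_le ⟨0, by rintro _ ⟨v, rfl⟩; exact frameDefect_nonneg v⟩ _

variable [CompleteSpace H]

/-- The projections of a family with small defect to the isotypic component are linearly
independent. -/
theorem linearIndependent_of_frameDefect_lt [Fintype ι] (v : ι → π.Ball)
    (h : frameDefect σ π v < 1 / (2 * Fintype.card ι + 3)) :
    LinearIndependent ℂ fun a => charProj σ π (v a).vec := by
  -- the Gram matrix of the projections has entries at most `2 * ε` off the diagonal and at least
  -- `1 - 3 * ε` on it
  set ε := frameDefect σ π v with hε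
  have hε0 : 0 ≤ ε := frameDefect_nonneg v
  have hcard : (0 : ℝ) < 2 * Fintype.card ι + 3 := by positivity
  rw [lt_div_iff₀ hcard] at h
  have hinner : ∀ a b, ⟪charProj σ π (v a).vec, charProj σ π (v b).vec⟫_ℂ =
      ⟪(v a).vec, (v b).vec⟫_ℂ + ⟪charProj σ π (v a).vec - (v a).vec, (v b).vec⟫_ℂ := by
    intro a b
    rw [← inner_charProj_left, charProj_charProj hσ, inner_sub_left]
    ring
  have herr : ∀ a b, ‖⟪charProj σ π (v a).vec - (v a).vec, (v b).vec⟫_ℂ‖ ≤ ε := by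
    intro a b
    refine (norm_inner_le_norm _ _).trans ?_
    have h1 := norm_charProj_sub_le_frameDefect (σ := σ) v a
    have h2 := (v b).norm_vec_le
    calc _ ≤ ε * 1 := mul_le_mul h1 h2 (norm_nonneg _) hε0
      _ = ε := mul_one _
  refine linearIndependent_of_norm_inner_le (δ := 2 * ε) (c := 1 - 3 * ε) (by positivity)
    (fun a b hab => ?_) (fun a => ?_) (by nlinarith)
  · rw [hinner]
    have := norm_inner_le_frameDefect (σ := σ) v hab
    linarith [norm_add_le ⟪(v a).vec, (v b).vec⟫_ℂ
      ⟪charProj σ π (v a).vec - (v a).vec, (v b).vec⟫_ℂ, herr a b]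
  · rw [hinner]
    have h1 := (abs_le.1 (abs_norm_sub_one_le_frameDefect (σ := σ) v a)).1
    have h2 : ‖⟪(v a).vec, (v a).vec⟫_ℂ‖ = ‖(v a).vec‖ ^ 2 := by
      rw [inner_self_eq_norm_sq_to_K]; simp
    have h3 := norm_sub_le_norm_add ⟪(v a).vec, (v a).vec⟫_ℂ
      ⟪charProj σ π (v a).vec - (v a).vec, (v a).vec⟫_ℂ
    have h4 := herr a a
    nlinarith [norm_nonneg (v a).vec]

theorem infMultValue_eq_zero_iff {n : ℕ} :
    infMultValue σ n π = 0 ↔ (n : ℕ∞) ≤ mult σ π := by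
  refine ⟨fun h => ?_, infMultValue_eq_zero hσ⟩
  have : Nonempty π.Ball := ⟨Ball.mk π 0 (by simp)⟩
  obtain ⟨v, hv⟩ := exists_lt_of_ciInf_lt (h.trans_lt (show (0 : ℝ) <
    1 / (2 * Fintype.card (Fin n × Fin (Module.finrank ℂ W)) + 3) by positivity))
  exact le_mult_of_linearIndependent hσ (linearIndependent_of_frameDefect_lt hσ v hv)
    fun a => charProj_mem_isotypic hσ π _

theorem forall_infMultValue_eq_zero_iff :
    (∀ n, infMultValue σ n π = 0) ↔ mult σ π = ⊤ := by
  simp_rw [infMultValue_eq_zero_iff hσ]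
  exact ⟨fun h => ENat.eq_top_iff_forall_ge.2 h, fun h n => h ▸ le_top⟩

theorem finMultValue_eq_zero {d : ℕ} (h : mult σ π = d) : finMultValue σ d π = 0 := by
  obtain ⟨v, hv, hs⟩ := exists_orthonormal_span_of_mult_eq hσ h
  have hmem : ∀ a, v a ∈ isotypic σ π := fun a => hs ▸ Submodule.subset_span ⟨a, rfl⟩
  have hnn : ∀ v : Fin d × Fin (Module.finrank ℂ W) → π.Ball, 0 ≤ ⨆ x : π.Ball,
      max (frameDefect σ π v)
        ‖charProj σ π x.vec - ∑ a, ⟪(v a).vec, charProj σ π x.vec⟫_ℂ • (v a).vec‖ :=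
    fun v => Real.iSup_nonneg fun x => le_max_of_le_left (frameDefect_nonneg v)
  refine le_antisymm ?_ (Real.iInf_nonneg hnn)
  refine (ciInf_le ⟨0, by rintro _ ⟨v, rfl⟩; exact hnn v⟩ (ballFamily π hv)).trans ?_
  refine Real.iSup_le (fun x => ?_) le_rfl
  rw [frameDefect_ballFamily hσ hv hmem]
  refine max_le le_rfl (le_of_eq ?_)
  rw [norm_eq_zero, sub_eq_zero]
  have hx : charProj σ π x.vec ∈ Submodule.span ℂ (Set.range v) :=
    hs ▸ charProj_mem_isotypic hσ π _
  obtain ⟨c, hc⟩ := (Submodule.mem_span_range_iff_exists_fun ℂ).1 hx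
  rw [← hc]
  refine Finset.sum_congr rfl fun a _ => ?_
  rw [vec_ballFamily, hv.inner_right_fintype]

/-- If the isotypic component had larger dimension, it would contain a unit vector orthogonal to
the projections of an almost optimal family, and the expansion of this vector would be `0`. -/
theorem finMultValue_eq_zero_iff {d : ℕ} :
    finMultValue σ d π = 0 ↔ mult σ π = d := by
  refine ⟨fun h => ?_, finMultValue_eq_zero hσ⟩
  have : Nonempty π.Ball := ⟨Ball.mk π 0 (by simp)⟩
  obtain ⟨v, hv⟩ := exists_lt_of_ciInf_lt (h.trans_lt (show (0 : ℝ) <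
    1 / (2 * Fintype.card (Fin d × Fin (Module.finrank ℂ W)) + 3) by positivity))
  set F : π.Ball → ℝ := fun x => max (frameDefect σ π v)
    ‖charProj σ π x.vec - ∑ a, ⟪(v a).vec, charProj σ π x.vec⟫_ℂ • (v a).vec‖ with hF
  have hbdd : BddAbove (Set.range F) := by
    refine ⟨max (frameDefect σ π v) (1 + ∑ a : Fin d × Fin (Module.finrank ℂ W), 1), ?_⟩
    rintro _ ⟨x, rfl⟩
    refine max_le_max le_rfl ((norm_sub_le _ _).trans ?_)
    have hx : ‖charProj σ π x.vec‖ ≤ 1 := (norm_charProj_le hσ π _).trans x.norm_vec_le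
    refine add_le_add hx ((norm_sum_le _ _).trans (Finset.sum_le_sum fun a _ => ?_))
    rw [norm_smul]
    have h1 := norm_inner_le_norm (𝕜 := ℂ) (v a).vec (charProj σ π x.vec)
    have h2 := (v a).norm_vec_le
    have h3 : ‖⟪(v a).vec, charProj σ π x.vec⟫_ℂ‖ ≤ 1 :=
      h1.trans (mul_le_one₀ h2 (norm_nonneg _) hx)
    exact mul_le_one₀ h3 (norm_nonneg _) h2
  have hx : ∀ x, F x < 1 / (2 * Fintype.card (Fin d × Fin (Module.finrank ℂ W)) + 3) :=
    fun x => (le_ciSup hbdd x).trans_lt hv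
  have hli := linearIndependent_of_frameDefect_lt hσ v
    ((le_max_left _ _).trans_lt (hx (Ball.mk π 0 (by simp))))
  have hPmem : ∀ a, charProj σ π (v a).vec ∈ isotypic σ π :=
    fun a => charProj_mem_isotypic hσ π _
  refine le_antisymm ?_ (le_mult_of_linearIndependent hσ hli hPmem)
  by_contra hlt
  rw [not_le] at hlt
  set S := Submodule.span ℂ (Set.range fun a => charProj σ π (v a).vec) with hS
  have hSfin : FiniteDimensional ℂ S := FiniteDimensional.span_of_finite ℂ (Set.finite_range _)
  have hle : ¬ isotypic σ π ≤ S := by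
    intro hle
    have hfin : FiniteDimensional ℂ (isotypic σ π) := Submodule.finiteDimensional_of_le hle
    have hle' := Submodule.finrank_mono hle
    obtain ⟨k, hk⟩ := ENat.ne_top_iff_exists.1 (mult_ne_top hσ hfin)
    rw [(finiteDimensional_isotypic hσ hk.symm).2, hS, finrank_span_eq_card hli] at hle'
    rw [← hk, Nat.cast_lt] at hlt
    have := nontrivial_of_irreducible hσ
    simp only [Fintype.card_prod, Fintype.card_fin] at hle'
    have := Nat.le_of_mul_le_mul_right hle' Module.finrank_pos
    omega
  obtain ⟨y, hyE, hyS⟩ := Set.not_subset.1 hle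
  set z := y - S.starProjection y with hz
  have hSE : S ≤ isotypic σ π := Submodule.span_le.2 (by rintro _ ⟨a, rfl⟩; exact hPmem a)
  have hzE : z ∈ isotypic σ π := sub_mem hyE (hSE (Submodule.starProjection_apply_mem S y))
  have hzS : z ∈ Sᗮ := Submodule.sub_starProjection_mem_orthogonal y
  have hz0 : z ≠ 0 := by
    intro h0
    apply hyS
    rw [sub_eq_zero.1 h0]
    exact Submodule.starProjection_apply_mem S y
  -- the normalization of `z` is the unit vector with trivial expansion
  set x : H := ((‖z‖⁻¹ : ℝ) : ℂ) • z with hxdef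
  have hxn : ‖x‖ = 1 := by
    rw [hxdef, norm_smul, Complex.norm_real, norm_inv, norm_norm,
      inv_mul_cancel₀ (norm_ne_zero_iff.2 hz0)]
  have hxE : charProj σ π x = x := charProj_of_mem_isotypic hσ (Submodule.smul_mem _ _ hzE)
  have hxS : x ∈ Sᗮ := Submodule.smul_mem _ _ hzS
  have hinner : ∀ a, ⟪(v a).vec, x⟫_ℂ = 0 := by
    intro a
    rw [← hxE, ← inner_charProj_left]
    exact hxS _ (Submodule.subset_span ⟨a, rfl⟩)
  have h1 := (le_max_right _ _).trans_lt (hx (Ball.mk π x hxn.le))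
  have h2 : (Ball.mk π x hxn.le).vec = x := rfl
  simp only [h2, hxE, hinner, zero_smul, Finset.sum_const_zero, sub_zero, hxn] at h1
  rw [lt_div_iff₀ (by positivity)] at h1
  have : (0 : ℝ) ≤ Fintype.card (Fin d × Fin (Module.finrank ℂ W)) := by positivity
  linarith

end Values

end UnitaryRep

namespace UnitaryRep

/-! ### Irreducible subrepresentations -/

section Irreducible

variable {G : Type u} [Group G] {H : Type v} [NormedAddCommGroup H] [InnerProductSpace ℂ H]

/-- The restriction of a unitary representation to an invariant subspace. -/
noncomputable def restrict (π : UnitaryRep G H) {A : Submodule ℂ H} (hA : π.Invariant A) :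
    UnitaryRep G A where
  toFun g :=
    { toLinearEquiv := LinearEquiv.ofLinearMap
        ((π g).toLinearEquiv.toLinearMap.restrict (hA g))
        ((π g⁻¹).toLinearEquiv.toLinearMap.restrict (hA g⁻¹))
        (by ext x; exact π.apply_inv_self' g x) (by ext x; exact π.inv_apply_self' g x)
      norm_map' := fun x => (π g).norm_map x }
  map_one' := by ext x; exact π.one_apply' (x : H)
  map_mul' g h := by ext x; exact π.mul_apply' g h (x : H)

/-- The transport of a unitary representation along a unitary isomorphism of Hilbert spaces. -/
noncomputable def transport {W : Type w} [NormedAddCommGroup W] [InnerProductSpace ℂ W] (π : UnitaryRep G H)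
    (e : H ≃ₗᵢ[ℂ] W) : UnitaryRep G W where
  toFun g := (e.symm.trans (π g)).trans e
  map_one' := by ext x; simp
  map_mul' g h := by ext x; simp

/-- Every nonzero finite-dimensional invariant subspace contains a copy of an irreducible
representation, on a space from any prescribed universe. -/
theorem Invariant.exists_irreducible_copy {π : UnitaryRep G H} {L : Submodule ℂ H}
    (hL : π.Invariant L) [FiniteDimensional ℂ L] (h0 : L ≠ ⊥) :
    ∃ (n : ℕ) (σ : UnitaryRep G (EuclideanSpace ℂ (ULift.{w} (Fin n))))
      (f : EuclideanSpace ℂ (ULift.{w} (Fin n)) →ₗᵢ[ℂ] H),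
      σ.toRepresentation.IsIrreducible ∧ IsCopy σ π f ∧ ∀ x, f x ∈ L := by
  classical
  -- a nonzero invariant subspace of minimal dimension is irreducible
  have hex : ∃ m : ℕ, ∃ V : Submodule ℂ H, π.Invariant V ∧ V ≤ L ∧ V ≠ ⊥ ∧
      Module.finrank ℂ V = m := ⟨_, L, hL, le_rfl, h0, rfl⟩
  obtain ⟨V, hV, hVL, hV0, hVm⟩ := Nat.find_spec hex
  have hmin : ∀ Y : Submodule ℂ H, π.Invariant Y → Y ≤ V → Y ≠ ⊥ → Y = V := by
    intro Y hY hYV hY0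
    have hfinV : FiniteDimensional ℂ V := Submodule.finiteDimensional_of_le hVL
    refine Submodule.eq_of_le_of_finrank_le hYV ?_
    rw [hVm]
    exact Nat.find_min' hex ⟨Y, hY, hYV.trans hVL, hY0, rfl⟩
  have hfinV : FiniteDimensional ℂ V := Submodule.finiteDimensional_of_le hVL
  let e : V ≃ₗᵢ[ℂ] EuclideanSpace ℂ (ULift.{w} (Fin (Module.finrank ℂ V))) :=
    ((stdOrthonormalBasis ℂ V).reindex Equiv.ulift.symm).repr
  let f : EuclideanSpace ℂ (ULift.{w} (Fin (Module.finrank ℂ V))) →ₗᵢ[ℂ] H :=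
    V.subtypeₗᵢ.comp e.symm.toLinearIsometry
  have hfV : ∀ x, f x ∈ V := fun x => (e.symm x).2
  have hf : IsCopy ((π.restrict hV).transport e) π f := by
    intro g x
    change ((e.symm (e (π.restrict hV g (e.symm x))) : V) : H) = _
    rw [LinearIsometryEquiv.symm_apply_apply]
    rfl
  have hVnt : Nontrivial V := Submodule.nontrivial_iff_ne_bot.2 hV0
  have hnt : Nontrivial (EuclideanSpace ℂ (ULift.{w} (Fin (Module.finrank ℂ V)))) :=
    e.symm.toEquiv.nontrivial
  refine ⟨_, (π.restrict hV).transport e, f, isIrreducible_of_invariant fun X hX => ?_, hf,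
    fun x => hVL (hfV x)⟩
  by_cases hX0 : X.map f.toLinearMap = ⊥
  · left
    rw [eq_bot_iff]
    intro x hx
    have : f x ∈ X.map f.toLinearMap := ⟨x, hx, rfl⟩
    rw [hX0, Submodule.mem_bot] at this
    exact f.injective (this.trans f.map_zero.symm)
  · right
    have hYV : X.map f.toLinearMap = V := by
      refine hmin _ ?_ ?_ hX0
      · rintro g _ ⟨x, hx, rfl⟩
        exact ⟨_, hX g x hx, hf g x⟩
      · rintro _ ⟨x, hx, rfl⟩
        exact hfV x
    rw [eq_top_iff]
    intro x _
    have : f x ∈ X.map f.toLinearMap := by rw [hYV]; exact hfV x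
    obtain ⟨y, hy, hxy⟩ := this
    rwa [← f.injective hxy]

end Irreducible

/-! ### Partial isomorphisms of unitary representations -/

variable {G : Type u} [Group G] {H : Type v₁} [NormedAddCommGroup H] [InnerProductSpace ℂ H]
  {K : Type v₂} [NormedAddCommGroup K] [InnerProductSpace ℂ K]

/-- The graph of an equivariant isometry between invariant subspaces of two unitary
representations. Graphs make the situation symmetric in the two representations. -/
structure IsPartialIso (π : UnitaryRep G H) (ρ : UnitaryRep G K)
    (Γ : Submodule ℂ (H × K)) : Prop where
  norm_eq : ∀ p ∈ Γ, ‖p.1‖ = ‖p.2‖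
  apply_mem : ∀ g, ∀ p ∈ Γ, (π g p.1, ρ g p.2) ∈ Γ

/-- The domain of the partial map with graph `Γ`. -/
abbrev graphDom (Γ : Submodule ℂ (H × K)) : Submodule ℂ H := Γ.map (LinearMap.fst ℂ H K)

/-- The range of the partial map with graph `Γ`. -/
abbrev graphRan (Γ : Submodule ℂ (H × K)) : Submodule ℂ K := Γ.map (LinearMap.snd ℂ H K)

/-- The inverse graph. -/
abbrev graphSwap (Γ : Submodule ℂ (H × K)) : Submodule ℂ (K × H) :=
  Γ.comap (LinearEquiv.prodComm ℂ K H).toLinearMap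

theorem mem_graphSwap {Γ : Submodule ℂ (H × K)} {p : K × H} :
    p ∈ graphSwap Γ ↔ (p.2, p.1) ∈ Γ := Iff.rfl

theorem finiteDimensional_graphSwap (Γ : Submodule ℂ (H × K)) [FiniteDimensional ℂ Γ] :
    FiniteDimensional ℂ (graphSwap Γ) :=
  LinearEquiv.finiteDimensional ((LinearEquiv.prodComm ℂ K H).symm.submoduleMap Γ ≪≫ₗ
    LinearEquiv.ofEq _ _ (Submodule.map_equiv_eq_comap_symm _ _))

/-- Every irreducible representation, on a space of the given universe, has the same multiplicity
in both representations. -/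
def SameMult (π : UnitaryRep G H) (ρ : UnitaryRep G K) : Prop :=
  ∀ (W : Type w) [NormedAddCommGroup W] [InnerProductSpace ℂ W] [FiniteDimensional ℂ W]
    (σ : UnitaryRep G W), σ.toRepresentation.IsIrreducible → σ.mult ρ = σ.mult π

theorem SameMult.symm {π : UnitaryRep G H} {ρ : UnitaryRep G K} (h : SameMult.{u, w} π ρ) :
    SameMult.{u, w} ρ π :=
  fun W _ _ _ σ hσ => (h W σ hσ).symm

namespace IsPartialIso

variable {π : UnitaryRep G H} {ρ : UnitaryRep G K} {Γ : Submodule ℂ (H × K)}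

theorem swap (hΓ : IsPartialIso π ρ Γ) : IsPartialIso ρ π (graphSwap Γ) where
  norm_eq p hp := (hΓ.norm_eq _ (mem_graphSwap.1 hp)).symm
  apply_mem g _ hp := by exact hΓ.apply_mem g _ (mem_graphSwap.1 hp)

theorem bot : IsPartialIso π ρ ⊥ where
  norm_eq := by simp
  apply_mem := by simp

theorem invariant_dom (hΓ : IsPartialIso π ρ Γ) : π.Invariant (graphDom Γ) := by
  rintro g _ ⟨p, hp, rfl⟩
  exact ⟨_, hΓ.apply_mem g p hp, rfl⟩

theorem invariant_ran (hΓ : IsPartialIso π ρ Γ) : ρ.Invariant (graphRan Γ) := by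
  rintro g _ ⟨p, hp, rfl⟩
  exact ⟨_, hΓ.apply_mem g p hp, rfl⟩

theorem fst_injOn (hΓ : IsPartialIso π ρ Γ) {p q : H × K} (hp : p ∈ Γ) (hq : q ∈ Γ)
    (h : p.1 = q.1) : p = q := by
  have := hΓ.norm_eq _ (sub_mem hp hq)
  rw [Prod.fst_sub, Prod.snd_sub, h, sub_self, norm_zero, eq_comm, norm_eq_zero,
    sub_eq_zero] at this
  exact Prod.ext h this

theorem finrank_map_fst (hΓ : IsPartialIso π ρ Γ) {Δ : Submodule ℂ (H × K)} (hΔ : Δ ≤ Γ) :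
    Module.finrank ℂ (Δ.map (LinearMap.fst ℂ H K)) = Module.finrank ℂ Δ := by
  rw [← LinearMap.range_domRestrict]
  refine LinearMap.finrank_range_of_inj fun p q h => Subtype.ext ?_
  exact hΓ.fst_injOn (hΔ p.2) (hΔ q.2) h

/-- Two orthogonal copies of the same representation can be matched in addition. -/
theorem sup_copies {W : Type w} [NormedAddCommGroup W] [InnerProductSpace ℂ W]
    {σ : UnitaryRep G W} (hΓ : IsPartialIso π ρ Γ) {f : W →ₗᵢ[ℂ] H} {h : W →ₗᵢ[ℂ] K}
    (hf : IsCopy σ π f) (hh : IsCopy σ ρ h) (hfo : ∀ w, f w ∈ (graphDom Γ)ᗮ)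
    (hho : ∀ w, h w ∈ (graphRan Γ)ᗮ) :
    IsPartialIso π ρ (Γ ⊔ LinearMap.range (f.toLinearMap.prod h.toLinearMap)) where
  norm_eq := by
    intro p hp
    obtain ⟨q, hq, _, ⟨w, rfl⟩, rfl⟩ := Submodule.mem_sup.1 hp
    rw [← sq_eq_sq₀ (norm_nonneg _) (norm_nonneg _), sq, sq]
    change ‖q.1 + f w‖ * ‖q.1 + f w‖ = ‖q.2 + h w‖ * ‖q.2 + h w‖
    have h1 : ⟪q.1, f w⟫_ℂ = 0 := hfo w _ ⟨q, hq, rfl⟩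
    have h2 : ⟪q.2, h w⟫_ℂ = 0 := hho w _ ⟨q, hq, rfl⟩
    rw [norm_add_sq_eq_norm_sq_add_norm_sq_of_inner_eq_zero _ _ h1,
      norm_add_sq_eq_norm_sq_add_norm_sq_of_inner_eq_zero _ _ h2,
      f.norm_map, h.norm_map, hΓ.norm_eq q hq]
  apply_mem := by
    intro g p hp
    obtain ⟨q, hq, _, ⟨w, rfl⟩, rfl⟩ := Submodule.mem_sup.1 hp
    refine Submodule.mem_sup.2 ⟨_, hΓ.apply_mem g q hq, _, ⟨σ g w, rfl⟩, ?_⟩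
    change (π g q.1 + f (σ g w), ρ g q.2 + h (σ g w)) = (π g (q.1 + f w), ρ g (q.2 + h w))
    rw [hf, hh, map_add, map_add]

theorem charProj_mem [Fintype G] {W : Type w} [NormedAddCommGroup W] [InnerProductSpace ℂ W]
    (σ : UnitaryRep G W) (hΓ : IsPartialIso π ρ Γ) {p : H × K} (hp : p ∈ Γ) :
    (charProj σ π p.1, charProj σ ρ p.2) ∈ Γ := by
  have : (charProj σ π p.1, charProj σ ρ p.2) =
      ((Module.finrank ℂ W : ℂ) / (Fintype.card G : ℂ)) •
      ∑ g : G, (starRingEnd ℂ) (σ.toRepresentation.character g) • (π g p.1, ρ g p.2) := by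
    ext <;> simp [charProj, Prod.fst_sum, Prod.snd_sum]
  rw [this]
  exact Submodule.smul_mem _ _ (Submodule.sum_mem _ fun g _ =>
    Submodule.smul_mem _ _ (hΓ.apply_mem g p hp))

/-- If `σ` has the same multiplicity in both representations and there is a copy of `σ`
orthogonal to the domain, then there is one orthogonal to the range: otherwise the isotypic
component on the right would lie in the range, and so would have smaller dimension than the one
on the left. -/
theorem exists_copy_orthogonal_ran [Fintype G] [CompleteSpace H] [CompleteSpace K]
    {W : Type w} [NormedAddCommGroup W] [InnerProductSpace ℂ W] [FiniteDimensional ℂ W]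
    {σ : UnitaryRep G W} (hσ : σ.toRepresentation.IsIrreducible)
    (hmult : mult σ ρ = mult σ π) (hΓ : IsPartialIso π ρ Γ) [FiniteDimensional ℂ Γ]
    {f : W →ₗᵢ[ℂ] H} (hf : IsCopy σ π f) (hfo : ∀ w, f w ∈ (graphDom Γ)ᗮ) :
    ∃ h : W →ₗᵢ[ℂ] K, IsCopy σ ρ h ∧ ∀ w, h w ∈ (graphRan Γ)ᗮ := by
  by_cases hle : isotypic σ ρ ≤ graphRan Γ
  · exfalso
    have hfin : FiniteDimensional ℂ (isotypic σ ρ) := Submodule.finiteDimensional_of_le hle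
    obtain ⟨d, hd⟩ := ENat.ne_top_iff_exists.1 (mult_ne_top hσ hfin)
    obtain ⟨-, hrK⟩ := finiteDimensional_isotypic hσ hd.symm
    obtain ⟨hfinH, hrH⟩ := finiteDimensional_isotypic hσ (hd.trans hmult).symm
    -- the part of `Γ` over the isotypic component on the right
    set Δ := Γ ⊓ (isotypic σ ρ).comap (LinearMap.snd ℂ H K) with hΔ
    have hΔfin : FiniteDimensional ℂ Δ := Submodule.finiteDimensional_of_le inf_le_left
    have h1 : Module.finrank ℂ (isotypic σ ρ) ≤ Module.finrank ℂ Δ := by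
      have : isotypic σ ρ ≤ Δ.map (LinearMap.snd ℂ H K) := by
        intro y hy
        obtain ⟨p, hp, rfl⟩ := hle hy
        exact ⟨p, ⟨hp, hy⟩, rfl⟩
      exact (Submodule.finrank_mono this).trans (Submodule.finrank_map_le _ _)
    have h2 : Δ.map (LinearMap.fst ℂ H K) ≤ graphDom Γ ⊓ isotypic σ π := by
      rintro _ ⟨p, hp, rfl⟩
      refine ⟨⟨p, hp.1, rfl⟩, ?_⟩
      have h3 : charProj σ ρ p.2 = p.2 := charProj_of_mem_isotypic hσ hp.2
      have h4 : (charProj σ π p.1, p.2) ∈ Γ := by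
        simpa only [h3] using hΓ.charProj_mem σ hp.1
      have h5 := hΓ.swap.fst_injOn (p := (p.2, charProj σ π p.1)) (q := (p.2, p.1))
        (mem_graphSwap.2 h4) (mem_graphSwap.2 hp.1) rfl
      exact (mem_isotypic_iff hσ).2 (congrArg Prod.snd h5)
    have h3 : Module.finrank ℂ (Δ.map (LinearMap.fst ℂ H K)) = Module.finrank ℂ Δ :=
      hΓ.finrank_map_fst inf_le_left
    have h4 : graphDom Γ ⊓ isotypic σ π < isotypic σ π := by
      refine lt_of_le_of_ne inf_le_right fun heq => ?_
      have := nontrivial_of_irreducible hσ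
      obtain ⟨w, hw⟩ := exists_ne (0 : W)
      have hmem : f w ∈ graphDom Γ := by
        have := hf.mem_isotypic w
        rw [← heq] at this
        exact this.1
      have := inner_self_eq_zero.1 (hfo w _ hmem)
      exact hw (f.injective (this.trans f.map_zero.symm))
    have h5 := Submodule.finrank_lt_finrank_of_lt h4
    have h6 := Submodule.finrank_mono h2
    omega
  · obtain ⟨y, hyE, hyB⟩ := Set.not_subset.1 hle
    set S := graphRan Γ with hS
    have hyB' : charProj σ ρ (y - S.starProjection y) ≠ 0 := by
      intro h0
      rw [← charProjL_apply, map_sub, charProjL_apply, charProjL_apply,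
        charProj_of_mem_isotypic hσ hyE, sub_eq_zero] at h0
      apply hyB
      rw [h0]
      exact UnitaryRep.charProj_mem σ hΓ.invariant_ran (Submodule.starProjection_apply_mem S y)
    exact exists_isCopy_mem hσ hΓ.invariant_ran.orthogonal
      (Submodule.sub_starProjection_mem_orthogonal y) hyB'

/-- One step of the back-and-forth argument: the domain of a finite-dimensional partial
isomorphism can be enlarged by any given vector. -/
theorem exists_extension [Fintype G] [CompleteSpace H] [CompleteSpace K]
    (hm : SameMult.{u, w} π ρ) (hΓ : IsPartialIso π ρ Γ) [FiniteDimensional ℂ Γ] (c : H) :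
    ∃ Γ' : Submodule ℂ (H × K), Γ ≤ Γ' ∧ IsPartialIso π ρ Γ' ∧ FiniteDimensional ℂ Γ' ∧
      c ∈ graphDom Γ' := by
  set S := π.orbitSpan c ⊔ graphDom Γ with hS
  have hSinv : π.Invariant S := (π.invariant_orbitSpan c).sup hΓ.invariant_dom
  have hcS : c ∈ S := Submodule.mem_sup_left (π.self_mem_orbitSpan c)
  -- inside `S` only finitely many dimensions can be added
  have key : ∀ (n : ℕ) (Γ₀ : Submodule ℂ (H × K)), Γ ≤ Γ₀ → IsPartialIso π ρ Γ₀ →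
      FiniteDimensional ℂ Γ₀ → graphDom Γ₀ ≤ S →
      Module.finrank ℂ S ≤ Module.finrank ℂ Γ₀ + n →
      ∃ Γ' : Submodule ℂ (H × K), Γ ≤ Γ' ∧ IsPartialIso π ρ Γ' ∧ FiniteDimensional ℂ Γ' ∧
        c ∈ graphDom Γ' := by
    intro n
    induction n with
    | zero =>
      intro Γ₀ hle h0 hfin hdom hrank
      refine ⟨Γ₀, hle, h0, hfin, ?_⟩
      rw [Submodule.eq_of_le_of_finrank_le hdom (by rwa [h0.finrank_map_fst le_rfl])]
      exact hcS
    | succ n ih =>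
      intro Γ₀ hle h0 hfin hdom hrank
      by_cases hc : c ∈ graphDom Γ₀
      · exact ⟨Γ₀, hle, h0, hfin, hc⟩
      have hL0 : S ⊓ (graphDom Γ₀)ᗮ ≠ ⊥ := by
        intro hbot
        have hmem : c - (graphDom Γ₀).starProjection c ∈ S ⊓ (graphDom Γ₀)ᗮ :=
          ⟨sub_mem hcS (hdom (Submodule.starProjection_apply_mem _ c)),
            Submodule.sub_starProjection_mem_orthogonal c⟩
        rw [hbot, Submodule.mem_bot, sub_eq_zero] at hmem
        apply hc
        rw [hmem]
        exact Submodule.starProjection_apply_mem _ c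
      have hfinL : FiniteDimensional ℂ ↥(S ⊓ (graphDom Γ₀)ᗮ) :=
        Submodule.finiteDimensional_of_le inf_le_left
      obtain ⟨m, σ, f, hσ, hf, hfL⟩ :=
        (hSinv.inf h0.invariant_dom.orthogonal).exists_irreducible_copy.{_, _, w} hL0
      obtain ⟨h, hh, hho⟩ := h0.exists_copy_orthogonal_ran hσ (hm _ σ hσ) hf
        fun x => (hfL x).2
      have := nontrivial_of_irreducible hσ
      obtain ⟨x, hx⟩ := exists_ne (0 : EuclideanSpace ℂ (ULift.{w} (Fin m)))
      refine ih _ (hle.trans le_sup_left) (h0.sup_copies hf hh (fun x => (hfL x).2) hho)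
        inferInstance ?_ ?_
      · rw [graphDom, Submodule.map_sup]
        refine sup_le hdom ?_
        rintro _ ⟨_, ⟨y, rfl⟩, rfl⟩
        exact (hfL y).1
      · have hlt : Γ₀ < Γ₀ ⊔ LinearMap.range (f.toLinearMap.prod h.toLinearMap) := by
          refine lt_of_le_of_ne le_sup_left fun heq => hx ?_
          have hmem : (f x, h x) ∈ Γ₀ := by
            rw [heq]
            exact Submodule.mem_sup_right ⟨x, rfl⟩
          have := inner_self_eq_zero.1 ((hfL x).2 _ ⟨_, hmem, rfl⟩)
          exact f.injective (this.trans f.map_zero.symm)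
        have := Submodule.finrank_lt_finrank_of_lt hlt
        omega
  exact key _ Γ le_rfl hΓ inferInstance le_sup_right (Nat.le_add_left _ _)

theorem exists_extension_ran [Fintype G] [CompleteSpace H] [CompleteSpace K]
    (hm : SameMult.{u, w} π ρ) (hΓ : IsPartialIso π ρ Γ) [FiniteDimensional ℂ Γ] (c : K) :
    ∃ Γ' : Submodule ℂ (H × K), Γ ≤ Γ' ∧ IsPartialIso π ρ Γ' ∧ FiniteDimensional ℂ Γ' ∧
      c ∈ graphRan Γ' := by
  have := finiteDimensional_graphSwap Γ
  obtain ⟨Δ, hle, hΔ, hΔfin, p, hp, rfl⟩ := hΓ.swap.exists_extension hm.symm c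
  refine ⟨graphSwap Δ, fun q hq => hle (mem_graphSwap.2 hq), hΔ.swap,
    finiteDimensional_graphSwap Δ, ?_⟩
  exact ⟨(p.2, p.1), mem_graphSwap.2 hp, rfl⟩

end IsPartialIso

/-! ### Unitary isomorphisms from dense graphs -/

theorem surjective_of_denseRange {E F : Type*} [NormedAddCommGroup E] [NormedSpace ℂ E]
    [NormedAddCommGroup F] [NormedSpace ℂ F] [CompleteSpace E] (f : E →ₗᵢ[ℂ] F)
    (hf : DenseRange f) : Function.Surjective f := by
  rw [← Set.range_eq_univ, ← f.isometry.isClosedEmbedding.isClosed_range.closure_eq]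
  exact hf.closure_range

/-- The graph of a linear isometry with dense domain and dense range extends to a unitary
operator: both projections of the closure of the graph are isometric. -/
theorem exists_unitary_of_graph [CompleteSpace H] [CompleteSpace K] {Γ : Submodule ℂ (H × K)}
    (hΓ : ∀ p ∈ Γ, ‖p.1‖ = ‖p.2‖) (hdom : Dense (graphDom Γ : Set H))
    (hran : Dense (graphRan Γ : Set K)) : ∃ U : H ≃ₗᵢ[ℂ] K, ∀ p ∈ Γ, U p.1 = p.2 := by
  have hcl : ∀ p ∈ Γ.topologicalClosure, ‖p.1‖ = ‖p.2‖ :=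
    closure_minimal hΓ (isClosed_eq (by fun_prop) (by fun_prop))
  have hcomplete : CompleteSpace Γ.topologicalClosure :=
    Γ.isClosed_topologicalClosure.completeSpace_coe
  let f₁ : Γ.topologicalClosure →ₗᵢ[ℂ] H :=
    ⟨LinearMap.fst ℂ H K ∘ₗ Γ.topologicalClosure.subtype, fun p => by
      change ‖(p : H × K).1‖ = ‖(p : H × K)‖
      rw [Prod.norm_def, hcl p p.2, max_self]⟩
  let f₂ : Γ.topologicalClosure →ₗᵢ[ℂ] K :=
    ⟨LinearMap.snd ℂ H K ∘ₗ Γ.topologicalClosure.subtype, fun p => by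
      change ‖(p : H × K).2‖ = ‖(p : H × K)‖
      rw [Prod.norm_def, hcl p p.2, max_self]⟩
  have h₁ : Function.Surjective f₁ := by
    have hsub : (graphDom Γ : Set H) ⊆ Set.range f₁ := by
      rintro _ ⟨p, hp, rfl⟩
      exact ⟨⟨p, Γ.le_topologicalClosure hp⟩, rfl⟩
    exact surjective_of_denseRange f₁ (hdom.mono hsub)
  have h₂ : Function.Surjective f₂ := by
    have hsub : (graphRan Γ : Set K) ⊆ Set.range f₂ := by
      rintro _ ⟨p, hp, rfl⟩
      exact ⟨⟨p, Γ.le_topologicalClosure hp⟩, rfl⟩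
    exact surjective_of_denseRange f₂ (hran.mono hsub)
  refine ⟨(LinearIsometryEquiv.ofSurjective f₁ h₁).symm.trans
    (LinearIsometryEquiv.ofSurjective f₂ h₂), fun p hp => ?_⟩
  have : (LinearIsometryEquiv.ofSurjective f₁ h₁).symm p.1 =
      ⟨p, Γ.le_topologicalClosure hp⟩ := by
    rw [LinearIsometryEquiv.symm_apply_eq]
    rfl
  rw [LinearIsometryEquiv.trans_apply, this]
  rfl

/-- Two representations on separable Hilbert spaces with the same multiplicities are unitarily
equivalent, by going back and forth between two total sequences. -/
theorem SameMult.exists_equiv [Fintype G] [CompleteSpace H] [CompleteSpace K]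
    {π : UnitaryRep G H} {ρ : UnitaryRep G K} (hm : SameMult.{u, w} π ρ) {x : ℕ → H} {y : ℕ → K}
    (hx : Dense (Submodule.span ℂ (Set.range x) : Set H))
    (hy : Dense (Submodule.span ℂ (Set.range y) : Set K)) :
    ∃ U : H ≃ₗᵢ[ℂ] K, ∀ g z, U (π g z) = ρ g (U z) := by
  let P := {Γ : Submodule ℂ (H × K) // IsPartialIso π ρ Γ ∧ FiniteDimensional ℂ Γ}
  have step : ∀ (n : ℕ) (Γ : P), ∃ Γ' : P, Γ.1 ≤ Γ'.1 ∧ x n ∈ graphDom Γ'.1 ∧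
      y n ∈ graphRan Γ'.1 := by
    rintro n ⟨Γ, hΓ, hfin⟩
    obtain ⟨Γ₁, hle₁, hΓ₁, hfin₁, hx₁⟩ := hΓ.exists_extension hm (x n)
    obtain ⟨Γ₂, hle₂, hΓ₂, hfin₂, hy₂⟩ := hΓ₁.exists_extension_ran hm (y n)
    exact ⟨⟨Γ₂, hΓ₂, hfin₂⟩, hle₁.trans hle₂, Submodule.map_mono hle₂ hx₁, hy₂⟩
  choose next hnext hnx hny using step
  let s : ℕ → P := fun n => Nat.rec ⟨⊥, .bot, inferInstance⟩ next n
  have hs : ∀ n, s (n + 1) = next n (s n) := fun n => rfl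
  have hmono : Monotone fun n => (s n).1 :=
    monotone_nat_of_le_succ fun n => (hs n).symm ▸ hnext n (s n)
  set Γ : Submodule ℂ (H × K) := ⨆ n, (s n).1 with hΓdef
  have hmem : ∀ p, p ∈ Γ ↔ ∃ n, p ∈ (s n).1 := fun p =>
    Submodule.mem_iSup_of_directed _ hmono.directed_le
  have hΓ : IsPartialIso π ρ Γ := by
    refine ⟨fun p hp => ?_, fun g p hp => ?_⟩
    · obtain ⟨n, hn⟩ := (hmem p).1 hp
      exact (s n).2.1.norm_eq p hn
    · obtain ⟨n, hn⟩ := (hmem p).1 hp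
      exact (hmem _).2 ⟨n, (s n).2.1.apply_mem g p hn⟩
  have hle : ∀ n, (s n).1 ≤ Γ := fun n p hp => (hmem p).2 ⟨n, hp⟩
  have hdom : Dense (graphDom Γ : Set H) := hx.mono <| by
    refine Submodule.span_le.2 ?_
    rintro _ ⟨n, rfl⟩
    exact Submodule.map_mono (hle (n + 1)) (hs n ▸ hnx n (s n))
  have hran : Dense (graphRan Γ : Set K) := hy.mono <| by
    refine Submodule.span_le.2 ?_
    rintro _ ⟨n, rfl⟩
    exact Submodule.map_mono (hle (n + 1)) (hs n ▸ hny n (s n))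
  obtain ⟨U, hU⟩ := exists_unitary_of_graph hΓ.norm_eq hdom hran
  refine ⟨U, fun g z => ?_⟩
  have hcl : IsClosed {z | U (π g z) = ρ g (U z)} :=
    isClosed_eq (by fun_prop) (by fun_prop)
  have hsub : (graphDom Γ : Set H) ⊆ {z | U (π g z) = ρ g (U z)} := by
    rintro _ ⟨p, hp, rfl⟩
    change U (π g p.1) = ρ g (U p.1)
    rw [hU p hp]
    exact hU _ (hΓ.apply_mem g p hp)
  exact closure_minimal hsub hcl (hdom z)

end UnitaryRep

namespace ContLanguage

/-! ### Formulas: quantification over tuples, and invariance under isomorphisms -/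

variable {S : ContLanguage.{u}} {M : Type v} [MetricSpace M] [S.lang.Structure M]

/-- A connective with inputs indexed by an arbitrary finite type. -/
noncomputable def Formula.connFintype {n : ℕ} {ι : Type*} [Fintype ι] (f : C(ι → ℝ, ℝ))
    (φ : ι → S.Formula n) : S.Formula n :=
  .conn ⟨fun x => f fun i => x (Fintype.equivFin ι i), by fun_prop⟩
    fun j => φ ((Fintype.equivFin ι).symm j)

@[simp]
theorem Formula.value_connFintype {n : ℕ} {ι : Type*} [Fintype ι] (f : C(ι → ℝ, ℝ))
    (φ : ι → S.Formula n) (a : Fin n → M) :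
    (Formula.connFintype f φ).value M a = f fun i => (φ i).value M a := by
  simp [Formula.connFintype, Formula.value]

/-- The supremum over all free variables. -/
def Formula.supAll : {n : ℕ} → S.Formula n → S.Sentence
  | 0, φ => φ
  | _ + 1, φ => (Formula.sup φ).supAll

/-- The infimum over all free variables. -/
def Formula.infAll : {n : ℕ} → S.Formula n → S.Sentence
  | 0, φ => φ
  | _ + 1, φ => (Formula.inf φ).infAll

theorem Formula.val_supAll [hM : S.IsMetricStructure M] {n : ℕ} (φ : S.Formula n) :
    φ.supAll.val M = ⨆ a : Fin n → M, φ.value M a := by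
  have := hM.nonempty
  induction n with
  | zero =>
    rw [ciSup_unique]
    exact congrArg (Formula.value M φ) (Subsingleton.elim _ _)
  | succ n ih =>
    obtain ⟨B, hB⟩ := φ.exists_abs_value_le M
    obtain ⟨B', hB'⟩ := (Formula.sup φ).exists_abs_value_le M
    have h1 : BddAbove (Set.range fun a => φ.value M a) :=
      ⟨B, by rintro _ ⟨a, rfl⟩; exact (abs_le.1 (hB a)).2⟩
    have h2 : BddAbove (Set.range fun a => (Formula.sup φ).value M a) :=
      ⟨B', by rintro _ ⟨a, rfl⟩; exact (abs_le.1 (hB' a)).2⟩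
    have h3 : ∀ a : Fin n → M, BddAbove (Set.range fun b : M => φ.value M (Fin.snoc a b)) :=
      fun a => ⟨B, by rintro _ ⟨b, rfl⟩; exact (abs_le.1 (hB _)).2⟩
    rw [Formula.supAll, ih]
    refine le_antisymm (ciSup_le fun a => ciSup_le fun b => le_ciSup h1 (Fin.snoc a b))
      (ciSup_le fun a => ?_)
    refine le_trans ?_ (le_ciSup h2 (Fin.init a))
    refine le_trans ?_ (le_ciSup (h3 (Fin.init a)) (a (Fin.last n)))
    rw [Fin.snoc_init_self]

theorem Formula.val_infAll [hM : S.IsMetricStructure M] {n : ℕ} (φ : S.Formula n) :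
    φ.infAll.val M = ⨅ a : Fin n → M, φ.value M a := by
  have := hM.nonempty
  induction n with
  | zero =>
    rw [ciInf_unique]
    exact congrArg (Formula.value M φ) (Subsingleton.elim _ _)
  | succ n ih =>
    obtain ⟨B, hB⟩ := φ.exists_abs_value_le M
    obtain ⟨B', hB'⟩ := (Formula.inf φ).exists_abs_value_le M
    have h1 : BddBelow (Set.range fun a => φ.value M a) :=
      ⟨-B, by rintro _ ⟨a, rfl⟩; exact (abs_le.1 (hB a)).1⟩
    have h2 : BddBelow (Set.range fun a => (Formula.inf φ).value M a) :=
      ⟨-B', by rintro _ ⟨a, rfl⟩; exact (abs_le.1 (hB' a)).1⟩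
    have h3 : ∀ a : Fin n → M, BddBelow (Set.range fun b : M => φ.value M (Fin.snoc a b)) :=
      fun a => ⟨-B, by rintro _ ⟨b, rfl⟩; exact (abs_le.1 (hB _)).1⟩
    rw [Formula.infAll, ih]
    refine le_antisymm (le_ciInf fun a => ?_)
      (le_ciInf fun a => le_ciInf fun b => ciInf_le h1 (Fin.snoc a b))
    refine le_trans (ciInf_le h2 (Fin.init a)) ?_
    refine le_trans (ciInf_le (h3 (Fin.init a)) (a (Fin.last n))) ?_
    rw [Fin.snoc_init_self]

/-- A nonnegative formula vanishing identically in `M` gives a condition of `Th(M)`. Hence it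
vanishes identically in all models. -/
theorem Formula.value_eq_zero_of_models [S.IsMetricStructure M] {N : Type w} [MetricSpace N]
    [S.lang.Structure N] [S.IsMetricStructure N] (hN : (S.completeTheory M).Models N)
    {n : ℕ} (φ : S.Formula n) (h0 : ∀ a : Fin n → N, 0 ≤ φ.value N a)
    (h : ∀ a : Fin n → M, φ.value M a = 0) (a : Fin n → N) : φ.value N a = 0 := by
  have h1 : φ.supAll.val M = 0 := by
    rw [Formula.val_supAll]
    simp [h]
  have h2 := hN _ h1
  rw [Formula.val_supAll] at h2
  obtain ⟨B, hB⟩ := φ.exists_abs_value_le N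
  refine le_antisymm ?_ (h0 a)
  rw [← h2]
  exact le_ciSup (f := fun a => φ.value N a)
    ⟨B, by rintro _ ⟨a, rfl⟩; exact (abs_le.1 (hB a)).2⟩ a

namespace Iso

variable {N : Type w} [MetricSpace N] [S.lang.Structure N]

theorem map_realize (e : S.Iso M N) {n : ℕ} (t : S.lang.Term (Fin n)) (a : Fin n → M) :
    e.toFun (t.realize a) = t.realize fun i => e.toFun (a i) := by
  induction t with
  | var i => rfl
  | func f ts ih =>
    rw [FirstOrder.Language.Term.realize_func, FirstOrder.Language.Term.realize_func, e.map_fun]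
    congr 1
    exact funext ih

theorem value_eq (e : S.Iso M N) {n : ℕ} (φ : S.Formula n) (a : Fin n → M) :
    φ.value N (fun i => e.toFun (a i)) = φ.value M a := by
  have hsnoc : ∀ {n : ℕ} (a : Fin n → M) (b : M),
      (fun i => e.toFun ((Fin.snoc a b : Fin (n + 1) → M) i)) =
        Fin.snoc (fun i => e.toFun (a i)) (e.toFun b) := by
    intro n a b
    funext i
    induction i using Fin.lastCases <;> simp
  induction φ with
  | dist s t =>
    simp only [Formula.value]
    rw [← e.map_realize, ← e.map_realize]
    exact e.toIsometryEquiv.isometry.dist_eq _ _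
  | conn f φ ih =>
    simp only [Formula.value]
    congr 1
    exact funext fun i => ih i a
  | sup φ ih =>
    simp only [Formula.value]
    refine (Function.Surjective.iSup_congr e.toFun e.toIsometryEquiv.surjective fun b => ?_).symm
    rw [← hsnoc, ih]
  | inf φ ih =>
    simp only [Formula.value]
    refine (Function.Surjective.iInf_congr e.toFun e.toIsometryEquiv.surjective fun b => ?_).symm
    rw [← hsnoc, ih]

theorem val_eq (e : S.Iso M N) (φ : S.Sentence) : φ.val N = φ.val M := by
  rw [Sentence.val, Sentence.val, ← e.value_eq]
  exact congrArg _ (Subsingleton.elim _ _)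

/-- The inverse of an isomorphism. -/
def symm (e : S.Iso M N) : S.Iso N M where
  toIsometryEquiv := e.toIsometryEquiv.symm
  map_fun f x := by
    refine e.toIsometryEquiv.injective ?_
    change e.toIsometryEquiv (e.toIsometryEquiv.symm _) = e.toFun _
    rw [IsometryEquiv.apply_symm_apply, e.map_fun]
    congr 1
    funext i
    exact (e.toIsometryEquiv.apply_symm_apply (x i)).symm

/-- The composition of isomorphisms. -/
def trans {P : Type*} [MetricSpace P] [S.lang.Structure P] (e : S.Iso M N) (e' : S.Iso N P) :
    S.Iso M P where
  toIsometryEquiv := e.toIsometryEquiv.trans e'.toIsometryEquiv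
  map_fun f x := by
    change e'.toFun (e.toFun _) = _
    rw [e.map_fun, e'.map_fun]
    rfl

end Iso

end ContLanguage

namespace UnitaryRep

variable {G : Type u} [Group G]

/-! ### Formulas are invariant under partial isomorphisms -/

section PartialIso

variable {H : Type v₁} [NormedAddCommGroup H] [InnerProductSpace ℂ H]
  {K : Type v₂} [NormedAddCommGroup K] [InnerProductSpace ℂ K]
  {π : UnitaryRep G H} {ρ : UnitaryRep G K}

theorem IsPartialIso.realize_mem {Γ : Submodule ℂ (H × K)} (hΓ : IsPartialIso π ρ Γ) {n : ℕ}
    (t : (repLanguage G).lang.Term (Fin n)) {a : Fin n → π.Ball} {b : Fin n → ρ.Ball}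
    (hab : ∀ i, ((a i).vec, (b i).vec) ∈ Γ) :
    ((t.realize a).vec, (t.realize b).vec) ∈ Γ := by
  induction t with
  | var i => exact hab i
  | func f ts ih =>
    change RepFunc G _ at f
    cases f with
    | zero => exact Γ.zero_mem
    | neg => exact Γ.neg_mem (ih 0)
    | dbl =>
      have h := hΓ.norm_eq _ (ih 0)
      have h1 : dblVec ((ts 0).realize b).vec =
          ((max ‖((ts 0).realize a).vec‖ (1 / 2))⁻¹ : ℝ) • ((ts 0).realize b).vec := by
        rw [dblVec, ← h]
      change (dblVec ((ts 0).realize a).vec, dblVec ((ts 0).realize b).vec) ∈ Γ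
      rw [h1]
      exact Γ.smul_of_tower_mem ((max ‖((ts 0).realize a).vec‖ (1 / 2))⁻¹ : ℝ) (ih 0)
    | mid => exact Γ.smul_of_tower_mem (1 / 2 : ℝ) (Γ.add_mem (ih 0) (ih 1))
    | rot q => exact Γ.smul_mem (rotScalar q) (ih 0)
    | act g => exact hΓ.apply_mem g _ (ih 0)

theorem exists_ball_of_mem {Γ : Submodule ℂ (H × K)} (hΓ : IsPartialIso π ρ Γ) {c : π.Ball}
    (hc : c.vec ∈ graphDom Γ) : ∃ d : ρ.Ball, (c.vec, d.vec) ∈ Γ := by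
  obtain ⟨p, hp, hpc⟩ := hc
  change p.1 = c.vec at hpc
  have hn : ‖p.2‖ ≤ 1 := by
    rw [← hΓ.norm_eq p hp, hpc]
    exact c.norm_vec_le
  refine ⟨Ball.mk ρ p.2 hn, ?_⟩
  rw [← hpc]
  exact hp

/-- Corresponding tuples have the same values on all formulas, by back and forth. -/
theorem IsPartialIso.value_eq [Fintype G] [CompleteSpace H] [CompleteSpace K]
    (hm : SameMult.{u, w} π ρ) {n : ℕ} (φ : (repLanguage G).Formula n)
    {Γ : Submodule ℂ (H × K)} (hΓ : IsPartialIso π ρ Γ) (hfin : FiniteDimensional ℂ Γ)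
    {a : Fin n → π.Ball} {b : Fin n → ρ.Ball} (hab : ∀ i, ((a i).vec, (b i).vec) ∈ Γ) :
    φ.value π.Ball a = φ.value ρ.Ball b := by
  have hsnoc : ∀ {n : ℕ} {Γ Γ' : Submodule ℂ (H × K)} (_ : Γ ≤ Γ') {a : Fin n → π.Ball}
      {b : Fin n → ρ.Ball} (_ : ∀ i, ((a i).vec, (b i).vec) ∈ Γ) {c : π.Ball} {d : ρ.Ball}
      (_ : (c.vec, d.vec) ∈ Γ') (i : Fin (n + 1)),
      (((Fin.snoc a c : Fin (n + 1) → π.Ball) i).vec,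
        ((Fin.snoc b d : Fin (n + 1) → ρ.Ball) i).vec) ∈ Γ' := by
    intro n Γ Γ' hle a b hab c d hcd i
    induction i using Fin.lastCases with
    | last => simpa using hcd
    | cast i => simpa using hle (hab i)
  induction φ generalizing Γ with
  | dist s t =>
    simp only [ContLanguage.Formula.value]
    rw [Ball.dist_eq, Ball.dist_eq]
    exact hΓ.norm_eq _ (sub_mem (hΓ.realize_mem s hab) (hΓ.realize_mem t hab))
  | conn f φ ih =>
    simp only [ContLanguage.Formula.value]
    congr 1
    exact funext fun i => ih i hΓ hfin hab
  | sup φ ih =>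
    simp only [ContLanguage.Formula.value]
    refine congrArg sSup (Set.ext fun r => ⟨?_, ?_⟩)
    · rintro ⟨c, rfl⟩
      obtain ⟨Γ', hle, hΓ', hfin', hc⟩ := hΓ.exists_extension hm c.vec
      obtain ⟨d, hd⟩ := exists_ball_of_mem hΓ' hc
      exact ⟨d, (ih hΓ' hfin' (hsnoc hle hab hd)).symm⟩
    · rintro ⟨d, rfl⟩
      obtain ⟨Γ', hle, hΓ', hfin', p, hp, hc⟩ := hΓ.exists_extension_ran hm d.vec
      obtain ⟨c, hc⟩ := exists_ball_of_mem hΓ'.swap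
        ⟨(p.2, p.1), mem_graphSwap.2 hp, hc⟩
      exact ⟨c, ih hΓ' hfin' (hsnoc hle hab hc)⟩
  | inf φ ih =>
    simp only [ContLanguage.Formula.value]
    refine congrArg sInf (Set.ext fun r => ⟨?_, ?_⟩)
    · rintro ⟨c, rfl⟩
      obtain ⟨Γ', hle, hΓ', hfin', hc⟩ := hΓ.exists_extension hm c.vec
      obtain ⟨d, hd⟩ := exists_ball_of_mem hΓ' hc
      exact ⟨d, (ih hΓ' hfin' (hsnoc hle hab hd)).symm⟩
    · rintro ⟨d, rfl⟩
      obtain ⟨Γ', hle, hΓ', hfin', p, hp, hc⟩ := hΓ.exists_extension_ran hm d.vec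
      obtain ⟨c, hc⟩ := exists_ball_of_mem hΓ'.swap
        ⟨(p.2, p.1), mem_graphSwap.2 hp, hc⟩
      exact ⟨c, ih hΓ' hfin' (hsnoc hle hab hc)⟩

/-- The multiplicities of the irreducible representations determine the theory. -/
theorem SameMult.val_eq [Fintype G] [CompleteSpace H] [CompleteSpace K]
    (hm : SameMult.{u, w} π ρ) (φ : (repLanguage G).Sentence) :
    φ.val π.Ball = φ.val ρ.Ball :=
  IsPartialIso.value_eq hm φ .bot inferInstance fun i => i.elim0

/-- The multiplicities determine whether the dimension is finite. -/
theorem SameMult.not_finiteDimensional [Fintype G] [CompleteSpace H] [CompleteSpace K]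
    (hm : SameMult.{u, w} π ρ) (hH : ¬ FiniteDimensional ℂ H) : ¬ FiniteDimensional ℂ K := by
  intro hK
  have key : ∀ n : ℕ, ∃ Γ : Submodule ℂ (H × K), IsPartialIso π ρ Γ ∧ FiniteDimensional ℂ Γ ∧
      n ≤ Module.finrank ℂ Γ := by
    intro n
    induction n with
    | zero => exact ⟨⊥, .bot, inferInstance, Nat.zero_le _⟩
    | succ n ih =>
      obtain ⟨Γ, hΓ, hfin, hn⟩ := ih
      obtain ⟨c, hc⟩ : ∃ c, c ∉ graphDom Γ := by
        by_contra! h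
        apply hH
        have : graphDom Γ = ⊤ := eq_top_iff.2 fun c _ => h c
        exact LinearEquiv.finiteDimensional (LinearEquiv.ofTop _ this)
      obtain ⟨Γ', hle, hΓ', hfin', hc'⟩ := hΓ.exists_extension hm c
      refine ⟨Γ', hΓ', hfin', ?_⟩
      have hlt : Γ < Γ' := lt_of_le_of_ne hle (by rintro rfl; exact hc hc')
      have := Submodule.finrank_lt_finrank_of_lt hlt
      omega
  obtain ⟨Γ, hΓ, hfin, hn⟩ := key (Module.finrank ℂ K + 1)
  have h1 : Module.finrank ℂ Γ ≤ Module.finrank ℂ K := by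
    refine LinearMap.finrank_le_finrank_of_injective
      (f := LinearMap.snd ℂ H K ∘ₗ Γ.subtype) fun p q h => Subtype.ext ?_
    have h2 := hΓ.norm_eq _ (sub_mem p.2 q.2)
    have h3 : (p : H × K).2 = (q : H × K).2 := h
    rw [Prod.fst_sub, Prod.snd_sub, h3, sub_self, norm_zero, norm_eq_zero, sub_eq_zero] at h2
    exact Prod.ext h2 h3
  omega

end PartialIso

end UnitaryRep

namespace UnitaryRep

/-! ### Formulas in the inner products of terms -/

section Kernel

variable (G : Type u) {M : Type v} [MetricSpace M] [(repLanguage G).lang.Structure M]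

variable {G} in
/-- The interpretation of a function symbol. -/
abbrev interp {n : ℕ} (f : RepFunc G n) (x : Fin n → M) : M :=
  FirstOrder.Language.Structure.funMap (L := (repLanguage G).lang) f x

/-- The real part of the inner product, expressed through distances. -/
noncomputable def kernelRe (x y : M) : ℝ :=
  (dist x (interp (G := G) .zero ![]) ^ 2 + dist y (interp (G := G) .zero ![]) ^ 2 -
    dist x y ^ 2) / 2

/-- The inner product of two points of the unit ball, expressed through distances. It makes sense
in all structures for the language. -/
noncomputable def kernel (x y : M) : ℂ :=
  kernelRe G x y + kernelRe G (interp (G := G) (.rot (1 / 4)) ![x]) y * Complex.I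

variable {G}

/-- Application of a function symbol to terms. -/
abbrev app {k n : ℕ} (f : RepFunc G k) (t : Fin k → (repLanguage G).lang.Term (Fin n)) :
    (repLanguage G).lang.Term (Fin n) :=
  FirstOrder.Language.Term.func (L := (repLanguage G).lang) f t

/-- The formula with value `kernelRe`. -/
noncomputable def kernelReFormula {n : ℕ} (s t : (repLanguage G).lang.Term (Fin n)) :
    (repLanguage G).Formula n :=
  .conn (k := 3) ⟨fun d => (d 0 ^ 2 + d 1 ^ 2 - d 2 ^ 2) / 2, by fun_prop⟩
    ![.dist s (app .zero ![]), .dist t (app .zero ![]), .dist s t]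

theorem value_kernelReFormula {n : ℕ} (s t : (repLanguage G).lang.Term (Fin n))
    (a : Fin n → M) :
    (kernelReFormula s t).value M a = kernelRe G (s.realize a) (t.realize a) := by
  have h : (app (G := G) .zero ![] : (repLanguage G).lang.Term (Fin n)).realize a =
      interp (G := G) .zero ![] :=
    congrArg (interp (G := G) .zero) (Subsingleton.elim _ _)
  simp [kernelReFormula, ContLanguage.Formula.value, kernelRe, h]

/-- The formula given by a continuous function of the inner products of terms. -/
noncomputable def gramFormula {n : ℕ} {I : Type*} [Fintype I]
    (t : I → (repLanguage G).lang.Term (Fin n)) (F : C(I → I → ℂ, ℝ)) :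
    (repLanguage G).Formula n :=
  .connFintype (ι := (I × I) ⊕ (I × I))
    ⟨fun x => F fun i j => x (.inl (i, j)) + x (.inr (i, j)) * Complex.I, by fun_prop⟩
    (Sum.elim (fun p => kernelReFormula (t p.1) (t p.2))
      fun p => kernelReFormula (app (.rot (1 / 4)) ![t p.1]) (t p.2))

theorem value_gramFormula {n : ℕ} {I : Type*} [Fintype I]
    (t : I → (repLanguage G).lang.Term (Fin n)) (F : C(I → I → ℂ, ℝ)) (a : Fin n → M) :
    (gramFormula t F).value M a =
      F fun i j => kernel G ((t i).realize a) ((t j).realize a) := by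
  have h : ∀ i, (app (.rot (1 / 4)) ![t i]).realize a =
      interp (G := G) (.rot (1 / 4)) ![(t i).realize a] := fun i => by
    refine congrArg (interp (G := G) (.rot (1 / 4))) (funext fun j => ?_)
    rw [Subsingleton.elim j 0]
    rfl
  simp only [gramFormula, ContLanguage.Formula.value_connFintype, ContinuousMap.coe_mk,
    Sum.elim_inl, Sum.elim_inr, value_kernelReFormula, h, kernel]

theorem rotScalar_quarter : rotScalar (1 / 4) = Complex.I := by
  have h : rotScalar (1 / 4) = Complex.exp (Real.pi / 2 * Complex.I) := by
    rw [rotScalar]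
    congr 1
    push_cast
    ring
  rw [h, Complex.exp_pi_div_two_mul_I]

section Ball

variable [Group G] {K : Type v} [NormedAddCommGroup K] [InnerProductSpace ℂ K] {ρ : UnitaryRep G K}

theorem kernelRe_ball (x y : ρ.Ball) : kernelRe G x y = (⟪x.vec, y.vec⟫_ℂ).re := by
  have h0 : (interp (G := G) .zero ![] : ρ.Ball).vec = 0 := rfl
  rw [kernelRe, Ball.dist_eq, Ball.dist_eq, Ball.dist_eq, h0, sub_zero, sub_zero,
    norm_sub_sq (𝕜 := ℂ)]
  simp

theorem kernel_ball (x y : ρ.Ball) : kernel G x y = ⟪x.vec, y.vec⟫_ℂ := by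
  have h : (interp (G := G) (.rot (1 / 4)) ![x] : ρ.Ball).vec = Complex.I • x.vec := by
    rw [← rotScalar_quarter]
    rfl
  rw [kernel, kernelRe_ball, kernelRe_ball, h, inner_smul_left]
  apply Complex.ext <;> simp

end Ball

end Kernel

/-- The squared norm of a linear combination as a function of the Gram matrix. The coefficients
may themselves depend on the Gram matrix. -/
noncomputable def combSq {I J : Type*} [Fintype J] (s : J → I) (c : J → C(I → I → ℂ, ℂ)) :
    C(I → I → ℂ, ℝ) :=
  ⟨fun Q => (∑ i, ∑ j, starRingEnd ℂ (c i Q) * c j Q * Q (s i) (s j)).re, by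
    refine Complex.continuous_re.comp (continuous_finsetSum _ fun i _ =>
      continuous_finsetSum _ fun j _ => ?_)
    exact ((Complex.continuous_conj.comp (c i).continuous).mul (c j).continuous).mul
      (by fun_prop)⟩

theorem combSq_gram {E : Type*} [NormedAddCommGroup E] [InnerProductSpace ℂ E] {I J : Type*}
    [Fintype J] (s : J → I) (c : J → C(I → I → ℂ, ℂ)) (x : I → E) :
    combSq s c (fun i j => ⟪x i, x j⟫_ℂ) =
      ‖∑ j, c j (fun i j => ⟪x i, x j⟫_ℂ) • x (s j)‖ ^ 2 := by
  rw [← inner_self_eq_norm_sq (𝕜 := ℂ), sum_inner]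
  simp_rw [inner_sum, inner_smul_left, inner_smul_right, ← mul_assoc]
  rfl

/-! ### The axioms as sentences -/

section Sentences

variable {G : Type u} [Group G] [Fintype G]
  {W : Type w} [NormedAddCommGroup W] [InnerProductSpace ℂ W]

/-- The coefficients of the isotypic projection. -/
noncomputable def projCoef (σ : UnitaryRep G W) (g : G) : ℂ :=
  ((Module.finrank ℂ W : ℂ) / (Fintype.card G : ℂ)) *
    (starRingEnd ℂ) (σ.toRepresentation.character g)

theorem charProj_eq_sum {K : Type v} [NormedAddCommGroup K] [InnerProductSpace ℂ K]
    (σ : UnitaryRep G W) (ρ : UnitaryRep G K) (x : K) :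
    charProj σ ρ x = ∑ g, projCoef σ g • ρ g x := by
  rw [charProj, Finset.smul_sum]
  simp_rw [smul_smul]
  rfl

/-- The coefficients of `P x - y` in terms of the vectors `π g x` and `y`. -/
noncomputable def projSubCoef {I : Type*} (σ : UnitaryRep G W) (j : Option G) :
    C(I → I → ℂ, ℂ) :=
  .const _ (j.elim (-1) (projCoef σ))

theorem sum_projSubCoef {K : Type v} [NormedAddCommGroup K] [InnerProductSpace ℂ K] {I : Type*}
    (σ : UnitaryRep G W) (ρ : UnitaryRep G K) {x : Option G → K} {z : K}
    (hx : ∀ g, x (some g) = ρ g z) (Q : I → I → ℂ) :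
    ∑ j, projSubCoef σ j Q • x j = charProj σ ρ z - x none := by
  rw [Fintype.sum_option, charProj_eq_sum]
  simp only [projSubCoef, ContinuousMap.const_apply, Option.elim, hx]
  module

/-- The formula with value `‖P x - y‖`. -/
noncomputable def projFormula (σ : UnitaryRep G W) : (repLanguage G).Formula 2 :=
  gramFormula (I := Option G)
    (fun j => j.elim (.var 1) fun g => app (.act g) ![.var 0])
    ⟨fun Q => √(combSq id (projSubCoef σ) Q), by fun_prop⟩

theorem value_projFormula {K : Type v} [NormedAddCommGroup K] [InnerProductSpace ℂ K]
    (σ : UnitaryRep G W) (ρ : UnitaryRep G K) (x y : ρ.Ball) :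
    (projFormula σ).value ρ.Ball ![x, y] = ‖charProj σ ρ x.vec - y.vec‖ := by
  simp only [projFormula, value_gramFormula, kernel_ball, ContinuousMap.coe_mk]
  rw [combSq_gram, Real.sqrt_sq (norm_nonneg _)]
  simp only [id]
  rw [sum_projSubCoef σ ρ (z := x.vec) (fun g => rfl)]
  rfl

theorem continuous_iSup_of_finite {X A : Type*} [TopologicalSpace X] [Finite A] {f : A → X → ℝ}
    (hf : ∀ a, Continuous (f a)) : Continuous fun x => ⨆ a, f a x := by
  have := Fintype.ofFinite A
  rcases isEmpty_or_nonempty A with h | h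
  · simp only [Real.iSup_of_isEmpty]
    exact continuous_const
  · simp_rw [← Finset.sup'_univ_eq_ciSup]
    exact Continuous.finset_sup'_apply _ fun a _ => hf a

/-- The defect of a family as a function of the Gram matrix of its translates; the index of the
translate by `g` of the vector with index `a` is `p a g`. -/
noncomputable def defectMap {A I : Type*} [Finite A] (σ : UnitaryRep G W) (p : A → G → I) :
    C(I → I → ℂ, ℝ) :=
  ⟨fun Q => ⨆ a : A, max (max |√(Q (p a 1) (p a 1)).re - 1|
      √(combSq (fun j : Option G => p a (j.getD 1)) (projSubCoef σ) Q))
      (⨆ b : {b : A // a ≠ b}, ‖Q (p a 1) (p b 1)‖), by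
    refine continuous_iSup_of_finite fun a => ?_
    refine Continuous.max (by fun_prop) ?_
    exact continuous_iSup_of_finite fun b => by fun_prop⟩

theorem defectMap_gram {A : Type} {I : Type*} [Finite A] {K : Type v} [NormedAddCommGroup K]
    [InnerProductSpace ℂ K] (σ : UnitaryRep G W) (ρ : UnitaryRep G K) {p : A → G → I}
    {x : I → K} {v : A → ρ.Ball} (hx : ∀ a g, x (p a g) = ρ g (v a).vec) :
    defectMap σ p (fun i j => ⟪x i, x j⟫_ℂ) = frameDefect σ ρ v := by
  simp only [defectMap, ContinuousMap.coe_mk, frameDefect]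
  have h1 : ∀ a, x (p a 1) = (v a).vec := fun a => by rw [hx, one_apply']
  refine congrArg iSup (funext fun a => ?_)
  rw [combSq_gram, Real.sqrt_sq (norm_nonneg _),
    sum_projSubCoef σ ρ (z := (v a).vec) (x := fun j : Option G => x (p a (j.getD 1)))
      (fun g => hx a g)]
  have h2 : √(⟪(v a).vec, (v a).vec⟫_ℂ).re = ‖(v a).vec‖ :=
    (norm_eq_sqrt_re_inner (𝕜 := ℂ) _).symm
  simp only [Option.getD_none, h1, h2]

/-- The maximum of the defect and of the distance from `P x` to its expansion, as a function of
the Gram matrix of the translates of the family and of `x`. -/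
noncomputable def expansionMap {A I : Type*} [Fintype A] (σ : UnitaryRep G W) (p : A → G → I)
    (q : G → I) : C(I → I → ℂ, ℝ) :=
  ⟨fun Q => max (defectMap σ p Q)
    √(combSq (Sum.elim q fun a => p a 1)
      (Sum.elim (fun g => .const _ (projCoef σ g))
        fun a => ⟨fun Q => -∑ g, projCoef σ g * Q (p a 1) (q g), by fun_prop⟩) Q),
    by fun_prop⟩

theorem expansionMap_gram {A : Type} {I : Type*} [Fintype A] {K : Type v}
    [NormedAddCommGroup K] [InnerProductSpace ℂ K] (σ : UnitaryRep G W) (ρ : UnitaryRep G K)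
    {p : A → G → I} {q : G → I} {x : I → K} {v : A → ρ.Ball} {z : ρ.Ball}
    (hx : ∀ a g, x (p a g) = ρ g (v a).vec) (hz : ∀ g, x (q g) = ρ g z.vec) :
    expansionMap σ p q (fun i j => ⟪x i, x j⟫_ℂ) = max (frameDefect σ ρ v)
      ‖charProj σ ρ z.vec - ∑ a, ⟪(v a).vec, charProj σ ρ z.vec⟫_ℂ • (v a).vec‖ := by
  have h1 : ∀ a, x (p a 1) = (v a).vec := fun a => by rw [hx, one_apply']
  simp only [expansionMap, ContinuousMap.coe_mk]
  rw [defectMap_gram σ ρ hx, combSq_gram, Real.sqrt_sq (norm_nonneg _), Fintype.sum_sum_type]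
  simp only [Sum.elim_inl, Sum.elim_inr, ContinuousMap.const_apply, ContinuousMap.coe_mk, h1, hz,
    neg_smul, Finset.sum_neg_distrib, ← sub_eq_add_neg]
  simp only [charProj_eq_sum, inner_sum, inner_smul_right]

/-- The sentence expressing the scheme for infinite multiplicity. -/
noncomputable def infMultSentence (σ : UnitaryRep G W) (n : ℕ) : (repLanguage G).Sentence :=
  .infAll (n := n * Module.finrank ℂ W) (gramFormula
    (I := (Fin n × Fin (Module.finrank ℂ W)) × G)
    (fun i => app (.act i.2) ![.var (finProdFinEquiv i.1)])
    (defectMap σ fun a g => (a, g)))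

/-- The sentence expressing finite multiplicity. -/
noncomputable def finMultSentence (σ : UnitaryRep G W) (d : ℕ) : (repLanguage G).Sentence :=
  .infAll (n := d * Module.finrank ℂ W) (.sup (gramFormula
    (I := (Fin d × Fin (Module.finrank ℂ W)) × G ⊕ G)
    (Sum.elim (fun i => app (.act i.2) ![.var (finProdFinEquiv i.1).castSucc])
      fun g => app (.act g) ![.var (Fin.last _)])
    (expansionMap σ (fun a g => .inl (a, g)) .inr)))

variable {K : Type v} [NormedAddCommGroup K] [InnerProductSpace ℂ K] [CompleteSpace K]

theorem val_infMultSentence (σ : UnitaryRep G W) (ρ : UnitaryRep G K) (n : ℕ) :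
    (infMultSentence σ n).val ρ.Ball = infMultValue σ n ρ := by
  rw [infMultSentence, ContLanguage.Formula.val_infAll, infMultValue]
  refine Equiv.iInf_congr (Equiv.arrowCongr finProdFinEquiv.symm (Equiv.refl _)) fun v => ?_
  rw [value_gramFormula]
  simp only [kernel_ball]
  symm
  exact defectMap_gram σ ρ (v := fun a => v (finProdFinEquiv a)) fun a g => rfl

theorem val_finMultSentence (σ : UnitaryRep G W) (ρ : UnitaryRep G K) (d : ℕ) :
    (finMultSentence σ d).val ρ.Ball = finMultValue σ d ρ := by
  rw [finMultSentence, ContLanguage.Formula.val_infAll, finMultValue]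
  refine Equiv.iInf_congr (Equiv.arrowCongr finProdFinEquiv.symm (Equiv.refl _)) fun v => ?_
  simp only [ContLanguage.Formula.value]
  refine iSup_congr fun z => ?_
  rw [value_gramFormula]
  simp only [kernel_ball]
  symm
  refine expansionMap_gram σ ρ (v := fun a => v (finProdFinEquiv a)) (z := z)
    (fun a g => ?_) fun g => ?_
  · refine congrArg (fun y : ρ.Ball => ρ g y.vec) ?_
    exact Fin.snoc_castSucc (α := fun _ => ρ.Ball) z v (finProdFinEquiv a)
  · refine congrArg (fun y : ρ.Ball => ρ g y.vec) ?_
    exact Fin.snoc_last (α := fun _ => ρ.Ball) z v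

end Sentences

end UnitaryRep

/-! ### Hilbert spaces from positive kernels -/

section Kernels

variable {X : Type v}

/-- A positive semidefinite kernel is the Gram matrix of a total family in a Hilbert space. -/
theorem exists_hilbert_of_kernel (k : X → X → ℂ) (hk : ∀ x y, k y x = starRingEnd ℂ (k x y))
    (hpos : ∀ (n : ℕ) (x : Fin n → X) (c : Fin n → ℂ),
      0 ≤ (∑ i, ∑ j, starRingEnd ℂ (c i) * c j * k (x i) (x j)).re) :
    ∃ (K : Type v) (_ : NormedAddCommGroup K) (_ : InnerProductSpace ℂ K)
      (_ : CompleteSpace K) (Φ : X → K), (∀ x y, ⟪Φ x, Φ y⟫_ℂ = k x y) ∧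
      Dense (Submodule.span ℂ (Set.range Φ) : Set K) := by
  classical
  -- the reproducing kernel Hilbert space takes operator-valued kernels; here `ℂ` acts on itself
  let A : Matrix X X (ℂ →L[ℂ] ℂ) := .of fun x y => k x y • ContinuousLinearMap.id ℂ ℂ
  have hA : ∀ x y z, A x y z = k x y * z := fun x y z => rfl
  have hherm : A.IsHermitian := by
    refine Matrix.IsHermitian.ext fun x y => ?_
    refine ContinuousLinearMap.ext fun z => ext_inner_left ℂ fun z' => ?_
    rw [ContinuousLinearMap.star_eq_adjoint, ContinuousLinearMap.adjoint_inner_right, hA, hA,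
      hk x y]
    simp only [RCLike.inner_apply, map_mul, Complex.conj_conj]
    ring
  have hpsd : A.PosSemidef := by
    have hiff : A.PosSemidef ↔ A.IsHermitian ∧ ∀ c : X →₀ ℂ,
        0 ≤ RCLike.re (c.sum fun x z => c.sum fun x' z' => ⟪A x' x z, z'⟫_ℂ) :=
      RKHS.posSemidef_tfae.out 0 2
    refine hiff.2 ⟨hherm, fun c => ?_⟩
    let e := c.support.equivFin
    have h := hpos _ (fun i => (e.symm i : X)) fun i => c (e.symm i)
    refine h.trans_eq ?_
    change _ = Complex.re _
    congr 1
    have hsum : ∀ F : X → ℂ, ∑ x ∈ c.support, F x = ∑ i, F (e.symm i) := fun F => by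
      rw [← Finset.sum_coe_sort c.support, ← Equiv.sum_comp e.symm]
    simp only [Finsupp.sum, hsum, RCLike.inner_apply, hA]
    refine Finset.sum_congr rfl fun i _ => Finset.sum_congr rfl fun j _ => ?_
    rw [map_mul, ← hk]
    ring
  have : Fact A.PosSemidef := ⟨hpsd⟩
  refine ⟨RKHS.OfKernel A, inferInstance, inferInstance, inferInstance,
    fun x => RKHS.kerFun (RKHS.OfKernel A) x 1, fun x y => ?_, ?_⟩
  · rw [← RKHS.kernel_inner, RKHS.OfKernel.kernel_ofKernel, hA, hk x y]
    simp
  · have h := RKHS.kerFun_dense (𝕜 := ℂ) (X := X) (V := ℂ) (RKHS.OfKernel A)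
    rw [← Submodule.dense_iff_topologicalClosure_eq_top] at h
    refine h.mono (Submodule.span_le.2 ?_)
    rintro _ ⟨x, z, rfl⟩
    have : RKHS.kerFun (RKHS.OfKernel A) x z = z • RKHS.kerFun (RKHS.OfKernel A) x 1 := by
      rw [← map_smul, smul_eq_mul, mul_one]
    rw [this]
    exact Submodule.smul_mem _ _ (Submodule.subset_span ⟨x, rfl⟩)

/-- Total families with the same Gram matrix are unitarily equivalent. -/
theorem exists_unitary_of_inner_eq {H : Type v₁} [NormedAddCommGroup H] [InnerProductSpace ℂ H]
    [CompleteSpace H] {K : Type v₂} [NormedAddCommGroup K] [InnerProductSpace ℂ K]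
    [CompleteSpace K] {Φ : X → H} {Ψ : X → K} (h : ∀ x y, ⟪Φ x, Φ y⟫_ℂ = ⟪Ψ x, Ψ y⟫_ℂ)
    (hΦ : Dense (Submodule.span ℂ (Set.range Φ) : Set H))
    (hΨ : Dense (Submodule.span ℂ (Set.range Ψ) : Set K)) :
    ∃ U : H ≃ₗᵢ[ℂ] K, ∀ x, U (Φ x) = Ψ x := by
  let L := (Finsupp.linearCombination ℂ Φ).prod (Finsupp.linearCombination ℂ Ψ)
  have hnorm : ∀ p ∈ LinearMap.range L, ‖p.1‖ = ‖p.2‖ := by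
    rintro _ ⟨c, rfl⟩
    change ‖Finsupp.linearCombination ℂ Φ c‖ = ‖Finsupp.linearCombination ℂ Ψ c‖
    rw [@norm_eq_sqrt_re_inner ℂ, @norm_eq_sqrt_re_inner ℂ]
    simp only [Finsupp.linearCombination_apply, Finsupp.sum_inner, Finsupp.inner_sum,
      inner_smul_left, inner_smul_right, h]
  have hdom : UnitaryRep.graphDom (LinearMap.range L) = Submodule.span ℂ (Set.range Φ) := by
    rw [UnitaryRep.graphDom, ← LinearMap.range_comp, LinearMap.fst_prod,
      Finsupp.range_linearCombination]
  have hran : UnitaryRep.graphRan (LinearMap.range L) = Submodule.span ℂ (Set.range Ψ) := by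
    rw [UnitaryRep.graphRan, ← LinearMap.range_comp, LinearMap.snd_prod,
      Finsupp.range_linearCombination]
  obtain ⟨U, hU⟩ := UnitaryRep.exists_unitary_of_graph hnorm (hdom ▸ hΦ) (hran ▸ hΨ)
  refine ⟨U, fun x => ?_⟩
  have := hU _ ⟨Finsupp.single x 1, rfl⟩
  simpa [L] using this

end Kernels

/-! ### The unit ball is generated by any total subset closed under the operations -/

section BallClosure

variable {K : Type v} [NormedAddCommGroup K] [InnerProductSpace ℂ K]

open UnitaryRep

/-- Repeated truncated doubling reaches the normalization of any nonzero vector. -/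
theorem inv_norm_smul_mem_of_dblVec_mem {C : Set K} (hdbl : ∀ x ∈ C, dblVec x ∈ C) (n : ℕ) :
    ∀ x ∈ C, (1 / 2 : ℝ) ^ n ≤ ‖x‖ → (‖x‖⁻¹ : ℝ) • x ∈ C := by
  have hbig : ∀ x ∈ C, 1 / 2 ≤ ‖x‖ → (‖x‖⁻¹ : ℝ) • x ∈ C := by
    intro x hx h
    have := hdbl x hx
    rwa [dblVec, max_eq_left h] at this
  induction n with
  | zero =>
    intro x hx h
    exact hbig x hx (by rw [pow_zero] at h; linarith)
  | succ n ih =>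
    intro x hx h
    rcases le_total (1 / 2) ‖x‖ with h2 | h2
    · exact hbig x hx h2
    · have h3 : dblVec x = (2 : ℝ) • x := by
        rw [dblVec, max_eq_right h2]
        norm_num
      have h4 : (2 : ℝ) • x ∈ C := h3 ▸ hdbl x hx
      have h5 : ‖(2 : ℝ) • x‖ = 2 * ‖x‖ := by rw [norm_smul]; norm_num
      have := ih _ h4 (by rw [h5]; rw [pow_succ] at h; linarith)
      rw [h5, smul_smul] at this
      convert! this using 2
      rw [mul_inv, mul_assoc, mul_comm, mul_assoc, mul_inv_cancel₀ two_ne_zero, mul_one]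

/-- A closed set of vectors which spans a dense subspace and is closed under the operations of
the language contains the unit ball. Its multiples by powers of `2` form a dense additive
subgroup, truncated doubling normalizes the vectors of this subgroup, and each vector of norm at
most `1` is the midpoint of two unit vectors. -/
theorem mem_of_closed_under_operations {C : Set K} (hcl : IsClosed C) (h0 : (0 : K) ∈ C)
    (hneg : ∀ x ∈ C, -x ∈ C) (hmid : ∀ x ∈ C, ∀ y ∈ C, (1 / 2 : ℝ) • (x + y) ∈ C)
    (hI : ∀ x ∈ C, Complex.I • x ∈ C) (hdbl : ∀ x ∈ C, dblVec x ∈ C)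
    (hdense : Dense (Submodule.span ℂ C : Set K)) {z : K} (hz : ‖z‖ ≤ 1) : z ∈ C := by
  have hhalf : ∀ x ∈ C, ∀ n : ℕ, ((1 / 2 : ℝ) ^ n) • x ∈ C := by
    intro x hx n
    induction n with
    | zero => simpa using hx
    | succ n ih =>
      have := hmid _ ih _ h0
      rwa [add_zero, smul_smul, ← pow_succ'] at this
  -- the multiples of `C` by powers of `2`
  let D : AddSubgroup K :=
    { carrier := {x | ∃ n : ℕ, ((1 / 2 : ℝ) ^ n) • x ∈ C}
      zero_mem' := ⟨0, by simpa using h0⟩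
      add_mem' := by
        rintro x y ⟨n, hn⟩ ⟨m, hm⟩
        refine ⟨n + m + 1, ?_⟩
        have h1 := hhalf _ hn m
        have h2 := hhalf _ hm n
        rw [smul_smul, ← pow_add] at h1 h2
        have := hmid _ h1 _ h2
        rw [add_comm m n, ← smul_add, smul_smul, ← pow_succ'] at this
        exact this
      neg_mem' := by
        rintro x ⟨n, hn⟩
        exact ⟨n, by rw [smul_neg]; exact hneg _ hn⟩ }
  have hCD : ∀ x ∈ C, x ∈ D := fun x hx => ⟨0, by simpa using hx⟩
  have hDhalf : ∀ x ∈ D, ∀ n : ℕ, ((1 / 2 : ℝ) ^ n) • x ∈ D := by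
    rintro x ⟨m, hm⟩ n
    refine ⟨m, ?_⟩
    rw [smul_comm]
    exact hhalf _ hm n
  -- the real `r` with `r • x` in the closure of `D` form a closed subgroup of `ℝ` with arbitrarily
  -- small positive elements
  have hreal : ∀ x ∈ D, ∀ r : ℝ, r • x ∈ D.topologicalClosure := by
    intro x hx r
    let R : AddSubgroup ℝ := D.topologicalClosure.comap (LinearMap.toSpanSingleton ℝ K x)
    have hR : Dense (R : Set ℝ) := by
      refine AddSubgroup.dense_of_not_isolated_zero R fun ε hε => ?_
      obtain ⟨n, hn⟩ := exists_pow_lt_of_lt_one hε (show (1 / 2 : ℝ) < 1 by norm_num)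
      exact ⟨(1 / 2) ^ n, D.le_topologicalClosure (hDhalf x hx n), by positivity, hn⟩
    have hRcl : IsClosed (R : Set ℝ) :=
      D.isClosed_topologicalClosure.preimage (by fun_prop : Continuous fun r : ℝ => r • x)
    have : r ∈ (R : Set ℝ) := by
      rw [← hRcl.closure_eq]
      exact hR r
    exact this
  have hcomplex : ∀ x ∈ C, ∀ c : ℂ, c • x ∈ D.topologicalClosure := by
    intro x hx c
    have : c • x = c.re • x + c.im • Complex.I • x := by
      conv_lhs => rw [← Complex.re_add_im c, add_smul, mul_smul]
      simp only [Complex.coe_smul]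
    rw [this]
    exact add_mem (hreal x (hCD x hx) _) (hreal _ (hCD _ (hI x hx)) _)
  have hD : Dense (D : Set K) := by
    have hle : (Submodule.span ℂ C : Set K) ⊆ closure (D : Set K) := by
      intro x hx
      obtain ⟨c, hc, rfl⟩ := Submodule.mem_span_set.1 hx
      exact D.topologicalClosure.sum_mem fun y hy => hcomplex y (hc hy) _
    exact dense_closure.1 (hdense.mono hle)
  -- normalization is continuous at unit vectors and maps `D` into `C`
  have hunit : ∀ x : K, ‖x‖ = 1 → x ∈ C := by
    intro x hx
    have hx0 : ‖x‖ ≠ 0 := by rw [hx]; exact one_ne_zero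
    have hcont : ContinuousAt (fun y : K => (‖y‖⁻¹ : ℝ) • y) x :=
      (continuous_norm.continuousAt.inv₀ hx0).smul continuousAt_id
    have h1 := mem_closure_image hcont (hD x)
    rw [hx, inv_one, one_smul] at h1
    refine hcl.closure_subset_iff.2 ?_ h1
    rintro _ ⟨y, ⟨n, hn⟩, rfl⟩
    rcases eq_or_ne y 0 with rfl | hy
    · simpa using h0
    · have hy' : 0 < ‖((1 / 2 : ℝ) ^ n) • y‖ :=
        norm_pos_iff.2 (smul_ne_zero (by positivity) hy)
      obtain ⟨m, hm⟩ := exists_pow_lt_of_lt_one hy' (show (1 / 2 : ℝ) < 1 by norm_num)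
      have := inv_norm_smul_mem_of_dblVec_mem hdbl m _ hn hm.le
      rw [smul_smul, norm_smul, Real.norm_of_nonneg (by positivity), mul_inv, mul_right_comm,
        inv_mul_cancel₀ (by positivity), one_mul] at this
      exact this
  rcases eq_or_ne z 0 with rfl | hz0
  · exact h0
  have hzn : ‖z‖ ≠ 0 := norm_ne_zero_iff.2 hz0
  -- `z` is the midpoint of the unit vectors `exp (± i θ) • e`
  set θ := Real.arccos ‖z‖ with hθ
  have hcos : Real.cos θ = ‖z‖ := Real.cos_arccos (by linarith [norm_nonneg z]) hz
  set e : K := ((‖z‖⁻¹ : ℝ) : ℂ) • z with he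
  have hen : ‖e‖ = 1 := by
    rw [he, norm_smul, Complex.norm_real, norm_inv, norm_norm, inv_mul_cancel₀ hzn]
  have hmem : ∀ t : ℝ, Complex.exp (t * Complex.I) • e ∈ C := by
    intro t
    refine hunit _ ?_
    rw [norm_smul, Complex.norm_exp_ofReal_mul_I, hen, one_mul]
  have := hmid _ (hmem θ) _ (hmem (-θ))
  convert! this using 1
  have h2 : Complex.exp (θ * Complex.I) + Complex.exp ((-θ : ℝ) * Complex.I) =
      2 * (‖z‖ : ℂ) := by
    rw [← hcos, Complex.ofReal_cos, Complex.cos]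
    push_cast
    ring
  rw [← add_smul, h2, he, ← Complex.coe_smul, smul_smul, smul_smul]
  have : ((1 / 2 : ℝ) : ℂ) * (2 * (‖z‖ : ℂ)) * ((‖z‖⁻¹ : ℝ) : ℂ) = 1 := by
    have : (‖z‖ : ℂ) ≠ 0 := by exact_mod_cast hzn
    push_cast
    field_simp
  rw [this, one_smul]

end BallClosure

namespace UnitaryRep

/-! ### Models of the theory are unit balls of representations -/

/-- Operators are determined on the unit ball. -/
theorem eq_of_eqOn_ball {M : Type*} {K : Type*} [NormedAddCommGroup K]
    [InnerProductSpace ℂ K] {Φ : M → K} (hrange : Set.range Φ = Metric.closedBall 0 1) {U V : K ≃ₗᵢ[ℂ] K}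
    (h : ∀ x, U (Φ x) = V (Φ x)) : U = V := by
  ext z
  rcases eq_or_ne z 0 with rfl | hz
  · simp
  have hmem : ((‖z‖⁻¹ : ℝ) : ℂ) • z ∈ Set.range Φ := by
    rw [hrange, mem_closedBall_zero_iff, norm_smul, Complex.norm_real, norm_inv, norm_norm,
      inv_mul_cancel₀ (norm_ne_zero_iff.2 hz)]
  obtain ⟨x, hx⟩ := hmem
  have h1 := h x
  rw [hx, map_smul, map_smul] at h1
  refine smul_right_injective K (r := ((‖z‖⁻¹ : ℝ) : ℂ)) ?_ h1
  exact_mod_cast inv_ne_zero (norm_ne_zero_iff.2 hz)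

section Models

variable {G : Type u} [Group G] {H : Type v} [NormedAddCommGroup H] [InnerProductSpace ℂ H]
  [CompleteSpace H] {π : UnitaryRep G H} {M : Type v₁} [MetricSpace M]
  [(repLanguage G).lang.Structure M] [(repLanguage G).IsMetricStructure M]

/-- Identities between inner products of terms transfer to all models. -/
theorem gram_transfer (hM : π.theory.Models M) {n : ℕ} {I : Type} [Fintype I]
    (t : I → (repLanguage G).lang.Term (Fin n)) (F : C(I → I → ℂ, ℝ)) (hF : ∀ Q, 0 ≤ F Q)
    (h : ∀ a : Fin n → π.Ball,
      F (fun i j => ⟪((t i).realize a).vec, ((t j).realize a).vec⟫_ℂ) = 0) (a : Fin n → M) :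
    F (fun i j => kernel G ((t i).realize a) ((t j).realize a)) = 0 := by
  rw [← value_gramFormula]
  refine ContLanguage.Formula.value_eq_zero_of_models hM _ (fun a => ?_) (fun a => ?_) a
  · rw [value_gramFormula]
    exact hF _
  · rw [value_gramFormula, ← h a]
    simp only [kernel_ball]

theorem kernel_conj_symm (hM : π.theory.Models M) (x y : M) :
    kernel G y x = starRingEnd ℂ (kernel G x y) := by
  have h := gram_transfer hM (n := 2) (I := Fin 2) (fun i => .var i)
    ⟨fun Q => ‖Q 1 0 - starRingEnd ℂ (Q 0 1)‖, by fun_prop⟩ (fun Q => norm_nonneg (E := ℂ) _)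
    (fun a => by simp [inner_conj_symm]) ![x, y]
  exact sub_eq_zero.1 (norm_eq_zero.1 h)

/-- Positive semidefiniteness is the condition that the negative part of the quadratic form
vanishes. -/
theorem kernel_nonneg (hM : π.theory.Models M) (n : ℕ) (x : Fin n → M) (c : Fin n → ℂ) :
    0 ≤ (∑ i, ∑ j, starRingEnd ℂ (c i) * c j * kernel G (x i) (x j)).re := by
  have h := gram_transfer hM (I := Fin n) (fun i => .var i)
    ⟨fun Q => max 0 (-combSq id (fun i => .const _ (c i)) Q), by fun_prop⟩
    (fun Q => le_max_left _ _) (fun a => by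
      simp only [ContinuousMap.coe_mk]
      rw [combSq_gram (x := fun i => ((FirstOrder.Language.Term.var i :
        (repLanguage G).lang.Term (Fin n)).realize a).vec)]
      exact max_eq_left (neg_nonpos.2 (sq_nonneg _))) x
  exact neg_nonpos.1 (max_eq_left_iff.1 h)

theorem norm_le_one_of_models (hM : π.theory.Models M) (x : M) : (kernel G x x).re ≤ 1 := by
  have h := gram_transfer hM (n := 1) (I := Fin 1) (fun i => .var i)
    ⟨fun Q => max 0 ((Q 0 0).re - 1), by fun_prop⟩
    (fun Q => le_max_left _ _) (fun a => by
      have h1 := (a 0).norm_vec_le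
      have h2 : (⟪(a 0).vec, (a 0).vec⟫_ℂ).re = ‖(a 0).vec‖ ^ 2 :=
        inner_self_eq_norm_sq (𝕜 := ℂ) _
      have h3 : ‖(a 0).vec‖ ^ 2 ≤ 1 := by nlinarith [norm_nonneg (a 0).vec]
      refine max_eq_left ?_
      change (⟪(a 0).vec, (a 0).vec⟫_ℂ).re - 1 ≤ 0
      linarith) ![x]
  have := max_eq_left_iff.1 h
  exact sub_nonpos.1 this

variable {K : Type v₁} [NormedAddCommGroup K] [InnerProductSpace ℂ K] {Φ : M → K}
  (hΦ : ∀ x y, ⟪Φ x, Φ y⟫_ℂ = kernel G x y)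
include hΦ

omit [Group G] [(repLanguage G).IsMetricStructure M] in
/-- The kernel is defined by polarization from the distance, so it recovers the distance. -/
theorem norm_sub_eq_dist (x y : M) :
    ‖Φ x - Φ y‖ = dist x y := by
  have hre : ∀ x y : M, (kernel G x y).re = kernelRe G x y := fun x y => by simp [kernel]
  have hself : ∀ x : M, ‖Φ x‖ ^ 2 = kernelRe G x x := fun x => by
    rw [← hre, ← hΦ]
    exact (inner_self_eq_norm_sq (𝕜 := ℂ) _).symm
  have h : ‖Φ x - Φ y‖ ^ 2 = dist x y ^ 2 := by
    rw [norm_sub_sq (𝕜 := ℂ), hself, hself, hΦ]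
    change _ - 2 * (kernel G x y).re + _ = _
    rw [hre, kernelRe, kernelRe, kernelRe, dist_self, dist_self]
    ring
  exact (sq_eq_sq₀ (norm_nonneg _) dist_nonneg).1 h

/-- Linear relations between terms, with coefficients depending on their inner products,
transfer to all models. -/
theorem relation_transfer (hM : π.theory.Models M) {n : ℕ} {I : Type} [Fintype I]
    (t : I → (repLanguage G).lang.Term (Fin n)) (c : I → C(I → I → ℂ, ℂ))
    (h : ∀ a : Fin n → π.Ball,
      ∑ i, c i (fun i j => ⟪((t i).realize a).vec, ((t j).realize a).vec⟫_ℂ) •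
        ((t i).realize a).vec = 0) (a : Fin n → M) :
    ∑ i, c i (fun i j => ⟪Φ ((t i).realize a), Φ ((t j).realize a)⟫_ℂ) •
      Φ ((t i).realize a) = 0 := by
  have h1 := gram_transfer hM t ⟨fun Q => |combSq id c Q|, by fun_prop⟩ (fun Q => abs_nonneg _)
    (fun a => by
      simp only [ContinuousMap.coe_mk]
      rw [combSq_gram (x := fun i => ((t i).realize a).vec)]
      simp only [id]
      rw [h a]
      simp) a
  simp only [ContinuousMap.coe_mk, ← hΦ, abs_eq_zero] at h1
  rw [combSq_gram (x := fun i => Φ ((t i).realize a))] at h1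
  simpa using h1

theorem map_zero_of_models (hM : π.theory.Models M) (a : Fin 0 → M) :
    Φ (interp (G := G) .zero a) = 0 := by
  have h := relation_transfer hΦ hM (n := 0) (I := Fin 1) (fun _ => app .zero .var)
    (fun _ => .const _ 1) (fun b => by
      have : ((app (G := G) .zero .var).realize b : π.Ball).vec = 0 := rfl
      simp [this]) a
  rw [Fin.sum_univ_one, ContinuousMap.const_apply, one_smul] at h
  exact h

theorem map_neg_of_models (hM : π.theory.Models M) (a : Fin 1 → M) :
    Φ (interp (G := G) .neg a) = -Φ (a 0) := by
  have h := relation_transfer hΦ hM (n := 1) (I := Fin 2) ![app .neg .var, .var 0]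
    (fun _ => .const _ 1) (fun b => by
      have : ((app (G := G) .neg .var).realize b : π.Ball).vec = -(b 0).vec := rfl
      simp only [Fin.sum_univ_two, Matrix.cons_val_zero, Matrix.cons_val_one, this,
        ContinuousMap.const_apply]
      simp) a
  rw [Fin.sum_univ_two] at h
  simp only [ContinuousMap.const_apply, one_smul] at h
  exact eq_neg_of_add_eq_zero_left h

theorem map_mid_of_models (hM : π.theory.Models M) (a : Fin 2 → M) :
    Φ (interp (G := G) .mid a) = (1 / 2 : ℝ) • (Φ (a 0) + Φ (a 1)) := by
  have h := relation_transfer hΦ hM (n := 2) (I := Fin 3) ![app .mid .var, .var 0, .var 1]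
    ![.const _ 1, .const _ (-(1 / 2 : ℝ)), .const _ (-(1 / 2 : ℝ))] (fun b => by
      have : ((app (G := G) .mid .var).realize b : π.Ball).vec =
        (1 / 2 : ℝ) • ((b 0).vec + (b 1).vec) := rfl
      rw [Fin.sum_univ_three]
      change (1 : ℂ) • ((app (G := G) .mid .var).realize b : π.Ball).vec +
        (-(1 / 2 : ℝ) : ℂ) • (b 0).vec + (-(1 / 2 : ℝ) : ℂ) • (b 1).vec = 0
      rw [this, ← Complex.coe_smul]
      module) a
  rw [Fin.sum_univ_three] at h
  change (1 : ℂ) • Φ (interp (G := G) .mid a) +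
    (-(1 / 2 : ℝ) : ℂ) • Φ (a 0) + (-(1 / 2 : ℝ) : ℂ) • Φ (a 1) = 0 at h
  rw [← Complex.coe_smul, ← sub_eq_zero, ← h]
  module

theorem map_rot_of_models (hM : π.theory.Models M) (q : ℚ) (a : Fin 1 → M) :
    Φ (interp (G := G) (.rot q) a) = rotScalar q • Φ (a 0) := by
  have h := relation_transfer hΦ hM (n := 1) (I := Fin 2) ![app (.rot q) .var, .var 0]
    ![.const _ 1, .const _ (-rotScalar q)] (fun b => by
      have : ((app (G := G) (.rot q) .var).realize b : π.Ball).vec =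
        rotScalar q • (b 0).vec := rfl
      rw [Fin.sum_univ_two]
      change (1 : ℂ) • ((app (G := G) (.rot q) .var).realize b : π.Ball).vec +
        (-rotScalar q) • (b 0).vec = 0
      rw [this]
      module) a
  rw [Fin.sum_univ_two] at h
  change (1 : ℂ) • Φ (interp (G := G) (.rot q) a) + (-rotScalar q) • Φ (a 0) = 0 at h
  rw [← sub_eq_zero, ← h]
  module

/-- The truncated doubling is a linear relation whose coefficient depends on the norm, that is, on
a diagonal entry of the Gram matrix. -/
theorem map_dbl_of_models (hM : π.theory.Models M) (a : Fin 1 → M) :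
    Φ (interp (G := G) .dbl a) = dblVec (Φ (a 0)) := by
  let c : C(Fin 2 → Fin 2 → ℂ, ℂ) :=
    ⟨fun Q => ((-(max √(Q 1 1).re (1 / 2))⁻¹ : ℝ) : ℂ), by
      refine Complex.continuous_ofReal.comp (Continuous.neg (Continuous.inv₀ (by fun_prop) ?_))
      intro Q
      exact (lt_max_of_lt_right (by norm_num)).ne'⟩
  have h := relation_transfer hΦ hM (n := 1) (I := Fin 2) ![app .dbl .var, .var 0]
    ![.const _ 1, c] (fun b => by
      have h1 : ((app (G := G) .dbl .var).realize b : π.Ball).vec = dblVec (b 0).vec := rfl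
      rw [Fin.sum_univ_two]
      change (1 : ℂ) • ((app (G := G) .dbl .var).realize b : π.Ball).vec +
        ((-(max √(⟪(b 0).vec, (b 0).vec⟫_ℂ).re (1 / 2))⁻¹ : ℝ) : ℂ) • (b 0).vec = 0
      have h2 : √(⟪(b 0).vec, (b 0).vec⟫_ℂ).re = ‖(b 0).vec‖ :=
        (norm_eq_sqrt_re_inner (𝕜 := ℂ) _).symm
      rw [h1, h2, dblVec, Complex.coe_smul]
      module) a
  rw [Fin.sum_univ_two] at h
  change (1 : ℂ) • Φ (interp (G := G) .dbl a) +
    ((-(max √(⟪Φ (a 0), Φ (a 0)⟫_ℂ).re (1 / 2))⁻¹ : ℝ) : ℂ) • Φ (a 0) = 0 at h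
  have h2 : √(⟪Φ (a 0), Φ (a 0)⟫_ℂ).re = ‖Φ (a 0)‖ :=
    (norm_eq_sqrt_re_inner (𝕜 := ℂ) _).symm
  rw [h2, Complex.coe_smul] at h
  rw [← sub_eq_zero, ← h, dblVec]
  module

theorem map_act_one_of_models (hM : π.theory.Models M) (a : Fin 1 → M) :
    Φ (interp (.act (1 : G)) a) = Φ (a 0) := by
  have h := relation_transfer hΦ hM (n := 1) (I := Fin 2) ![app (.act (1 : G)) .var, .var 0]
    ![.const _ 1, .const _ (-1)] (fun b => by
      have : ((app (.act (1 : G)) .var).realize b : π.Ball).vec = (b 0).vec :=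
        π.one_apply' (b 0).vec
      rw [Fin.sum_univ_two]
      change (1 : ℂ) • ((app (.act (1 : G)) .var).realize b : π.Ball).vec +
        (-1 : ℂ) • (b 0).vec = 0
      rw [this]
      module) a
  rw [Fin.sum_univ_two] at h
  change (1 : ℂ) • Φ (interp (.act (1 : G)) a) + (-1 : ℂ) • Φ (a 0) = 0 at h
  rw [← sub_eq_zero, ← h]
  module

theorem map_act_mul_of_models (hM : π.theory.Models M) (g g' : G) (a : Fin 1 → M) :
    Φ (interp (.act (g * g')) a) = Φ (interp (.act g) fun _ => interp (.act g') a) := by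
  have h := relation_transfer hΦ hM (n := 1) (I := Fin 2)
    ![app (.act (g * g')) .var, app (.act g) fun _ => app (.act g') .var]
    ![.const _ 1, .const _ (-1)] (fun b => by
      have : ((app (.act (g * g')) .var).realize b : π.Ball).vec =
          ((app (.act g) fun _ => app (.act g') .var).realize b : π.Ball).vec :=
        π.mul_apply' g g' (b 0).vec
      rw [Fin.sum_univ_two]
      change (1 : ℂ) • ((app (.act (g * g')) .var).realize b : π.Ball).vec +
        (-1 : ℂ) • ((app (.act g) fun _ => app (.act g') .var).realize b : π.Ball).vec = 0
      rw [this]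
      module) a
  rw [Fin.sum_univ_two] at h
  change (1 : ℂ) • Φ (interp (.act (g * g')) a) +
    (-1 : ℂ) • Φ (interp (.act g) fun _ => interp (.act g') a) = 0 at h
  rw [← sub_eq_zero, ← h]
  module

omit hΦ in
theorem kernel_act_of_models (hM : π.theory.Models M) (g : G) (x y : M) :
    kernel G (interp (.act g) fun _ => x) (interp (.act g) fun _ => y) = kernel G x y := by
  have h := gram_transfer hM (n := 2) (I := Fin 4)
    ![app (.act g) fun _ => .var 0, app (.act g) fun _ => .var 1, .var 0, .var 1]
    ⟨fun Q => ‖Q 0 1 - Q 2 3‖, by fun_prop⟩ (fun Q => norm_nonneg (E := ℂ) _)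
    (fun a => by
      change ‖⟪π g (a 0).vec, π g (a 1).vec⟫_ℂ - ⟪(a 0).vec, (a 1).vec⟫_ℂ‖ = 0
      rw [(π g).inner_map_map, sub_self, norm_zero]) ![x, y]
  exact sub_eq_zero.1 (norm_eq_zero.1 h)

/-- The image of a model in its Hilbert space is the unit ball. -/
theorem range_eq_closedBall (hM : π.theory.Models M)
    (hdense : Dense (Submodule.span ℂ (Set.range Φ) : Set K)) :
    Set.range Φ = Metric.closedBall 0 1 := by
  have : CompleteSpace M := ContLanguage.IsMetricStructure.complete (repLanguage G)
  have hiso : Isometry Φ := Isometry.of_dist_eq fun x y => by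
    rw [dist_eq_norm, norm_sub_eq_dist hΦ]
  refine Set.Subset.antisymm ?_ fun z hz => ?_
  · rintro _ ⟨x, rfl⟩
    rw [mem_closedBall_zero_iff]
    have h1 := norm_le_one_of_models hM x
    rw [← hΦ] at h1
    have h2 : ‖Φ x‖ ^ 2 ≤ 1 := (inner_self_eq_norm_sq (𝕜 := ℂ) (Φ x)).symm.trans_le h1
    nlinarith [norm_nonneg (Φ x)]
  · refine mem_of_closed_under_operations hiso.isClosedEmbedding.isClosed_range
      ⟨_, map_zero_of_models hΦ hM Fin.elim0⟩ ?_ ?_ ?_ ?_ hdense (mem_closedBall_zero_iff.1 hz)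
    · rintro _ ⟨x, rfl⟩
      exact ⟨_, map_neg_of_models hΦ hM ![x]⟩
    · rintro _ ⟨x, rfl⟩ _ ⟨y, rfl⟩
      exact ⟨_, map_mid_of_models hΦ hM ![x, y]⟩
    · rintro _ ⟨x, rfl⟩
      exact ⟨_, (map_rot_of_models hΦ hM (1 / 4) ![x]).trans (by rw [rotScalar_quarter]; rfl)⟩
    · rintro _ ⟨x, rfl⟩
      exact ⟨_, map_dbl_of_models hΦ hM ![x]⟩

omit hΦ in
/-- Every model is isomorphic to the unit ball of a unitary representation, on the Hilbert space
generated by the model with the inner product read off from the distances. -/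
theorem exists_iso_ball_of_models (hM : π.theory.Models M) :
    ∃ (K : Type v₁) (_ : NormedAddCommGroup K) (_ : InnerProductSpace ℂ K)
      (_ : CompleteSpace K) (ρ : UnitaryRep G K), Nonempty ((repLanguage G).Iso M ρ.Ball) := by
  obtain ⟨K, _, _, _, Φ, hΦ, hdense⟩ :=
    exists_hilbert_of_kernel (kernel G (M := M)) (kernel_conj_symm hM) (kernel_nonneg hM)
  have hrange := range_eq_closedBall hΦ hM hdense
  have hiso : Isometry Φ := Isometry.of_dist_eq fun x y => by
    rw [dist_eq_norm, norm_sub_eq_dist hΦ]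
  have hU : ∀ g : G, ∃ U : K ≃ₗᵢ[ℂ] K, ∀ x, U (Φ x) = Φ (interp (.act g) fun _ => x) := by
    intro g
    refine exists_unitary_of_inner_eq (fun x y => ?_) hdense ?_
    · rw [hΦ, hΦ, kernel_act_of_models hM]
    · refine hdense.mono (Submodule.span_mono ?_)
      rintro _ ⟨x, rfl⟩
      refine ⟨interp (.act g⁻¹) fun _ => x, ?_⟩
      change Φ (interp (.act g) fun _ => interp (.act g⁻¹) fun _ => x) = Φ x
      rw [← map_act_mul_of_models hΦ hM g g⁻¹ fun _ => x, mul_inv_cancel,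
        map_act_one_of_models hΦ hM]
  choose U hU using hU
  let ρ : UnitaryRep G K :=
    { toFun := U
      map_one' := eq_of_eqOn_ball hrange fun x => by
        rw [hU, map_act_one_of_models hΦ hM]
        rfl
      map_mul' := fun g g' => eq_of_eqOn_ball hrange fun x => by
        rw [hU, map_act_mul_of_models hΦ hM g g' fun _ => x]
        change _ = U g (U g' (Φ x))
        rw [hU, hU] }
  have hball : ∀ x, ‖Φ x‖ ≤ 1 := fun x => by
    rw [← mem_closedBall_zero_iff, ← hrange]
    exact ⟨x, rfl⟩
  let e : M → ρ.Ball := fun x => Ball.mk ρ (Φ x) (hball x)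
  have he : Isometry e := Isometry.of_dist_eq fun x y => by
    rw [Ball.dist_eq]
    exact norm_sub_eq_dist hΦ x y
  have hsurj : Function.Surjective e := by
    intro y
    have : y.vec ∈ Set.range Φ := by
      rw [hrange, mem_closedBall_zero_iff]
      exact y.norm_vec_le
    obtain ⟨x, hx⟩ := this
    exact ⟨x, Subtype.ext hx⟩
  have hmap : ∀ {n : ℕ} (f : RepFunc G n) (x : Fin n → M),
      e (interp f x) = ρ.ballFun f fun i => e (x i) := by
    intro n f x
    refine Subtype.ext ?_
    change Φ (interp f x) = (ρ.ballFun f fun i => e (x i)).vec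
    cases f with
    | zero => exact map_zero_of_models hΦ hM x
    | neg => exact map_neg_of_models hΦ hM x
    | dbl => exact map_dbl_of_models hΦ hM x
    | mid => exact map_mid_of_models hΦ hM x
    | rot q => exact map_rot_of_models hΦ hM q x
    | act g =>
      have hx : x = fun _ => x 0 := funext fun i => congrArg x (Subsingleton.elim i 0)
      rw [hx]
      exact (hU g (x 0)).symm
  refine ⟨K, inferInstance, inferInstance, inferInstance, ρ, ⟨?_⟩⟩
  exact { toEquiv := Equiv.ofBijective e ⟨he.injective, hsurj⟩
          isometry_toFun := he
          map_fun := fun f x => hmap f x }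

end Models

end UnitaryRep

namespace UnitaryRep

/-! ### Categoricity and axiomatization -/

section Theory

variable {G : Type u} [Group G]

/-- An equivariant unitary operator restricts to an isomorphism of the unit balls. -/
def ballIso {K : Type v₁} [NormedAddCommGroup K] [InnerProductSpace ℂ K] {K' : Type v₂}
    [NormedAddCommGroup K'] [InnerProductSpace ℂ K'] {ρ : UnitaryRep G K}
    {ρ' : UnitaryRep G K'} (U : K ≃ₗᵢ[ℂ] K') (hU : ∀ g z, U (ρ g z) = ρ' g (U z)) :
    (repLanguage G).Iso ρ.Ball ρ'.Ball where
  toFun x := Ball.mk ρ' (U x.vec) (by rw [U.norm_map]; exact x.norm_vec_le)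
  invFun y := Ball.mk ρ (U.symm y.vec) (by rw [U.symm.norm_map]; exact y.norm_vec_le)
  left_inv x := Subtype.ext (U.symm_apply_apply x.vec)
  right_inv y := Subtype.ext (U.apply_symm_apply y.vec)
  isometry_toFun := Isometry.of_dist_eq fun x y => by
    rw [Ball.dist_eq, Ball.dist_eq]
    change ‖U x.vec - U y.vec‖ = _
    rw [← map_sub, U.norm_map]
  map_fun f x := by
    refine Subtype.ext ?_
    change RepFunc G _ at f
    cases f with
    | zero => exact U.map_zero
    | neg => exact U.map_neg _
    | dbl =>
      change U (dblVec (x 0).vec) = dblVec (U (x 0).vec)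
      rw [dblVec, dblVec, U.norm_map]
      exact U.toLinearEquiv.toLinearMap.map_smul_of_tower _ _
    | mid =>
      change U ((1 / 2 : ℝ) • ((x 0).vec + (x 1).vec)) =
        (1 / 2 : ℝ) • (U (x 0).vec + U (x 1).vec)
      rw [← map_add]
      exact U.toLinearEquiv.toLinearMap.map_smul_of_tower _ _
    | rot q => exact U.map_smul _ _
    | act g => exact hU g _

theorem dense_span_of_denseRange {K : Type v} [NormedAddCommGroup K] [InnerProductSpace ℂ K]
    {ρ : UnitaryRep G K} {x : ℕ → ρ.Ball} (hx : DenseRange x) :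
    Dense (Submodule.span ℂ (Set.range fun n => (x n).vec) : Set K) := by
  have hball : ∀ y : ρ.Ball,
      y.vec ∈ (Submodule.span ℂ (Set.range fun n => (x n).vec)).topologicalClosure := by
    intro y
    refine map_mem_closure (f := Ball.vec) continuous_subtype_val (hx y) ?_
    rintro _ ⟨n, rfl⟩
    exact Submodule.subset_span ⟨n, rfl⟩
  intro z
  change z ∈ (Submodule.span ℂ (Set.range fun n => (x n).vec)).topologicalClosure
  rcases eq_or_ne z 0 with rfl | hz
  · exact Submodule.zero_mem _
  have hz' : (‖z‖ : ℂ) ≠ 0 := by exact_mod_cast norm_ne_zero_iff.2 hz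
  have h1 : ‖(‖z‖ : ℂ)⁻¹ • z‖ ≤ 1 := by
    rw [norm_smul, norm_inv, Complex.norm_real, norm_norm,
      inv_mul_cancel₀ (norm_ne_zero_iff.2 hz)]
  have h2 := Submodule.smul_mem _ (‖z‖ : ℂ) (hball (Ball.mk ρ _ h1))
  change (‖z‖ : ℂ) • (‖z‖ : ℂ)⁻¹ • z ∈ _ at h2
  rwa [smul_smul, mul_inv_cancel₀ hz', one_smul] at h2

variable [Fintype G] {H : Type v} [NormedAddCommGroup H] [InnerProductSpace ℂ H]
  [CompleteSpace H] {π : UnitaryRep G H}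

/-- The theory determines the multiplicities. -/
theorem sameMult_of_models {K : Type v₁} [NormedAddCommGroup K] [InnerProductSpace ℂ K]
    [CompleteSpace K] {ρ : UnitaryRep G K} (h : π.theory.Models ρ.Ball) :
    SameMult.{u, w} π ρ := by
  intro W _ _ _ σ hσ
  rcases eq_or_ne (mult σ π) ⊤ with htop | htop
  · rw [htop, ← forall_infMultValue_eq_zero_iff hσ]
    intro n
    rw [← val_infMultSentence]
    refine h _ ?_
    change (infMultSentence σ n).val π.Ball = 0
    rw [val_infMultSentence]
    exact (forall_infMultValue_eq_zero_iff hσ).2 htop n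
  · obtain ⟨d, hd⟩ := ENat.ne_top_iff_exists.1 htop
    rw [← hd, ← finMultValue_eq_zero_iff hσ, ← val_finMultSentence]
    refine h _ ?_
    change (finMultSentence σ d).val π.Ball = 0
    rw [val_finMultSentence]
    exact (finMultValue_eq_zero_iff hσ).2 hd.symm

variable {M : Type v₁} [MetricSpace M] [(repLanguage G).lang.Structure M]

/-- A structure isomorphic to the unit ball of a representation with the same multiplicities is a
model. -/
theorem models_of_iso {K : Type v₂} [NormedAddCommGroup K] [InnerProductSpace ℂ K]
    [CompleteSpace K] {ρ : UnitaryRep G K} (hm : SameMult.{u, w} π ρ)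
    (e : (repLanguage G).Iso M ρ.Ball) : π.theory.Models M := by
  intro φ hφ
  rw [← e.val_eq, ← hm.val_eq]
  exact hφ

variable [(repLanguage G).IsMetricStructure M]

theorem exists_iso_ball_sameMult (hM : π.theory.Models M) :
    ∃ (K : Type v₁) (_ : NormedAddCommGroup K) (_ : InnerProductSpace ℂ K)
      (_ : CompleteSpace K) (ρ : UnitaryRep G K), SameMult.{u, w} π ρ ∧
        Nonempty ((repLanguage G).Iso M ρ.Ball) := by
  obtain ⟨K, _, _, _, ρ, ⟨e⟩⟩ := exists_iso_ball_of_models hM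
  refine ⟨K, inferInstance, inferInstance, inferInstance, ρ, sameMult_of_models ?_, ⟨e⟩⟩
  intro φ hφ
  rw [e.val_eq]
  exact hM φ hφ

end Theory

/-- Any two separable models are unit balls of representations with the same multiplicities, and
these are unitarily equivalent. -/
theorem isAleph0Categorical_theory {G : Type u} [Group G] [Fintype G] {H : Type v}
    [NormedAddCommGroup H] [InnerProductSpace ℂ H] [CompleteSpace H] (π : UnitaryRep G H) :
    ContLanguage.Theory.IsAleph0Categorical.{u, v₁, v₂} π.theory := by
  intro M _ _ _ N _ _ _ hMsep hNsep hM hN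
  obtain ⟨K, _, _, _, ρ, hρ, ⟨e⟩⟩ := exists_iso_ball_sameMult.{u, v, 0} hM
  obtain ⟨K', _, _, _, ρ', hρ', ⟨e'⟩⟩ := exists_iso_ball_sameMult.{u, v, 0} hN
  have hm : SameMult.{u, 0} ρ ρ' := fun W _ _ _ σ hσ =>
    (hρ' W σ hσ).trans (hρ W σ hσ).symm
  have := (ContLanguage.IsMetricStructure.nonempty (repLanguage G) : Nonempty M)
  have := (ContLanguage.IsMetricStructure.nonempty (repLanguage G) : Nonempty N)
  have hx := e.toIsometryEquiv.surjective.denseRange.comp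
    (TopologicalSpace.denseRange_denseSeq M) e.toIsometryEquiv.continuous
  have hy := e'.toIsometryEquiv.surjective.denseRange.comp
    (TopologicalSpace.denseRange_denseSeq N) e'.toIsometryEquiv.continuous
  obtain ⟨U, hU⟩ := hm.exists_equiv (dense_span_of_denseRange hx) (dense_span_of_denseRange hy)
  exact ⟨(e.trans (ballIso U hU)).trans e'.symm⟩

end UnitaryRep

theorem mainTheorem3 {G : Type u} [Group G] [Fintype G]
    {H : Type v} [NormedAddCommGroup H] [InnerProductSpace ℂ H] [CompleteSpace H]
    (hH : ¬ FiniteDimensional ℂ H) (π : UnitaryRep G H) :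
    -- the theory is categorical in density character `ℵ₀`
    ContLanguage.Theory.IsAleph0Categorical.{u, v₁, v₂} π.theory ∧
    -- the theory says exactly what the multiplicity of each irreducible representation is
    (∀ (M : Type v₁) [MetricSpace M] [(repLanguage G).lang.Structure M]
      [(repLanguage G).IsMetricStructure M],
      π.theory.Models M ↔
        ∃ (K : Type v₁) (_ : NormedAddCommGroup K) (_ : InnerProductSpace ℂ K)
          (_ : CompleteSpace K) (ρ : UnitaryRep G K),
          ¬ FiniteDimensional ℂ K ∧
          (∀ (W : Type w) [NormedAddCommGroup W] [InnerProductSpace ℂ W]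
            [FiniteDimensional ℂ W] (σ : UnitaryRep G W),
            σ.toRepresentation.IsIrreducible → σ.mult ρ = σ.mult π) ∧
          Nonempty ((repLanguage G).Iso M ρ.Ball)) ∧
    ∀ (W : Type w) [NormedAddCommGroup W] [InnerProductSpace ℂ W] [FiniteDimensional ℂ W]
      (σ : UnitaryRep G W), σ.toRepresentation.IsIrreducible →
      -- the character formula gives the orthogonal projection onto the isotypic component
      (∀ (K : Type v₁) [NormedAddCommGroup K] [InnerProductSpace ℂ K] [CompleteSpace K]
        (ρ : UnitaryRep G K) (x : K), σ.charProj ρ x ∈ σ.isotypic ρ ∧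
          ∀ y ∈ σ.isotypic ρ, ⟪y, x - σ.charProj ρ x⟫_ℂ = 0) ∧
      -- this projection is definable
      (∀ ε : ℝ, 0 < ε → ∃ φ : (repLanguage G).Formula 2,
        ∀ (K : Type v₁) [NormedAddCommGroup K] [InnerProductSpace ℂ K] [CompleteSpace K]
          (ρ : UnitaryRep G K) (x y : ρ.Ball),
          |φ.value ρ.Ball ![x, y] - ‖σ.charProj ρ x.vec - y.vec‖| ≤ ε) ∧
      -- axioms, written with this projection, for infinite multiplicity
      (∃ φ : ℕ → (repLanguage G).Sentence,
        ∀ (K : Type v₁) [NormedAddCommGroup K] [InnerProductSpace ℂ K] [CompleteSpace K]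
          (ρ : UnitaryRep G K),
          (∀ n, (φ n).val ρ.Ball = σ.infMultValue n ρ) ∧
          ((∀ n, (φ n).val ρ.Ball = 0) ↔ σ.mult ρ = ⊤)) ∧
      -- an axiom, written with this projection, for each finite multiplicity
      (∃ ψ : ℕ → (repLanguage G).Sentence,
        ∀ (K : Type v₁) [NormedAddCommGroup K] [InnerProductSpace ℂ K] [CompleteSpace K]
          (ρ : UnitaryRep G K) (d : ℕ),
          (ψ d).val ρ.Ball = σ.finMultValue d ρ ∧
          ((ψ d).val ρ.Ball = 0 ↔ σ.mult ρ = (d : ℕ∞))) := by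
  refine ⟨UnitaryRep.isAleph0Categorical_theory π, ?_, ?_⟩
  · intro M _ _ _
    constructor
    · intro hM
      obtain ⟨K, _, _, _, ρ, hm, he⟩ := UnitaryRep.exists_iso_ball_sameMult.{u, v, w} hM
      exact ⟨K, inferInstance, inferInstance, inferInstance, ρ, hm.not_finiteDimensional hH,
        hm, he⟩
    · rintro ⟨K, _, _, _, ρ, -, hm, ⟨e⟩⟩
      exact UnitaryRep.models_of_iso hm e
  · intro W _ _ _ σ hσ
    refine ⟨fun K _ _ _ ρ x => ⟨UnitaryRep.charProj_mem_isotypic hσ ρ x,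
      fun y hy => UnitaryRep.inner_sub_charProj hσ x hy⟩, fun ε hε => ⟨UnitaryRep.projFormula σ, ?_⟩,
      ⟨UnitaryRep.infMultSentence σ, ?_⟩, ⟨UnitaryRep.finMultSentence σ, ?_⟩⟩
    · intro K _ _ _ ρ x y
      rw [UnitaryRep.value_projFormula, sub_self, abs_zero]
      exact hε.le
    · intro K _ _ _ ρ
      simp only [UnitaryRep.val_infMultSentence, UnitaryRep.forall_infMultValue_eq_zero_iff hσ, implies_true, and_self]
    · intro K _ _ _ ρ d
      simp only [UnitaryRep.val_finMultSentence, UnitaryRep.finMultValue_eq_zero_iff hσ, and_self]
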